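/- Let $m,d\ge 0$ be integers. For each agent $i\in\{1,\dots,m\}$ let $\Pi_i=\begin{bmatrix}\Pi_{i+}\\ \Pi_{i-}\end{bmatrix}\in\mathbb R^{d\times d}$ be a permutation matrix with $\Pi_{i+}\in\mathbb R^{d_i\times d}$ (the features seen by agent $i$) and $\Pi_{i-}\in\mathbb R^{(d-d_i)\times d}$ (the unseen ones), and suppose that every one of the $d$ features is seen by at least one agent. Write $v_{i\pm}=\Pi_{i\pm}v$ for $v\in\mathbb R^d$, and $A_{i+}=\Pi_{i+}A\Pi_{i+}^\top$, $A_{i\pm}=\Pi_{i+}A\Pi_{i-}^\top$, $A_{i\mp}=\Pi_{i-}A\Pi_{i+}^\top$ for $A\in\mathbb R^{d\times d}$. Let $P$ be a probability distribution on $\mathbb R^d$ with finite second moments, mean zero and covariance matrix $\Sigma\succ 0$; let $\theta\in\mathbb R^d$ and $\sigma>0$. For $x\sim P$ put $z_{i+}=x_{i-}-\Sigma_{i\mp}\Sigma_{i+}^{-1}x_{i+}$, and assume that for every $i$ the random vector $x_{i+}\,\theta_{i-}^\top z_{i+}$ is square integrable. Let $T_i=\begin{bmatrix} I_{d_i} &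 \Sigma_{i+}^{-1}\Sigma_{i\pm}\end{bmatrix}\Pi_i\in\mathbb R^{d_i\times d}$. Each agent $i$ has feature vectors $x_i^1,x_i^2,\dots\sim P$ and noise variables $\xi_i^1,\xi_i^2,\dots\sim\mathsf N(0,\sigma^2)$, all of these (over all agents and samples) mutually independent. For $n\ge 0$ let $X_i\in\mathbb R^{n\times d}$ be the matrix with rows $x_i^1,\dots,x_i^n$, let $X_{i+}=X_i\Pi_{i+}^\top$ and $y_i=X_i\theta+(\xi_i^1,\dots,\xi_i^n)^\top$, and let $\hat\theta_i=X_{i+}^\dagger y_i$ be the local least squares estimate, where $\dagger$ is the Moore–Penrose inverse. For positive definite matrices $W_i\in\mathbb R^{d_i\times d_i}$ $(i=1,\dots,m)$ let $$\hat\theta=\hat\theta(W_1,\dots,W_m)=\operatorname*{arg\,min}_{t\in\mathbb R^d}\ \sum_{i=1}^m v_i(t)^\top W_i\,v_i(t),\qquad v_i(t)=t_{i+}+\Sigma_{i+}^{-1}\Sigma_{i\pm}t_{i-}-\hat\theta_i .$$ Then this minimizer exists and is unique (for all data and every $n$), and there is a function $C$ that assigns to $(W_1,\dots,W_m)$ a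 matrix in $\mathbb R^{d\times d}$ such that the following hold. 1. For all positive definite $W_1,\dots,W_m$, the matrix $C(W_1,\dots,W_m)$ is positive semidefinite and $$\sqrt n\,(\hat\theta(W_1,\dots,W_m)-\theta)\ \xrightarrow{\ d\ }\ \mathsf N\bigl(0,C(W_1,\dots,W_m)\bigr)\qquad(n\to\infty).$$ 2. The matrices $$W_i^\star=\Sigma_{i+}\bigl(\mathbb E[x_{i+}\theta_{i-}^\top z_{i+}z_{i+}^\top\theta_{i-}x_{i+}^\top]+\sigma^2\Sigma_{i+}\bigr)^{-1}\Sigma_{i+}$$ are positive definite, and they are an optimal choice of weights: for all positive definite $W_1,\dots,W_m$, in the positive semidefinite order, $$C(W_1,\dots,W_m)\ \succeq\ C(W_1^\star,\dots,W_m^\star)=\Bigl(\sum_{i=1}^m T_i^\top W_i^\star T_i\Bigr)^{-1}.$$ -/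

import Mathlib

open MeasureTheory ProbabilityTheory Filter Matrix
open scoped NNReal

noncomputable section

namespace Collab

/-! ### The Moore–Penrose inverse -/

/-- `B` is a Moore–Penrose inverse of the real matrix `A` (the four Penrose equations). -/
structure IsMoorePenrose {n p : ℕ} (A : Matrix (Fin n) (Fin p) ℝ)
    (B : Matrix (Fin p) (Fin n) ℝ) : Prop where
  mul_mul_left : A * B * A = A
  mul_mul_right : B * A * B = B
  symm_left : (A * B)ᵀ = A * B
  symm_right : (B * A)ᵀ = B * A

theorem exists_isMoorePenrose {n p : ℕ} (A : Matrix (Fin n) (Fin p) ℝ) :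
    ∃ B, IsMoorePenrose A B := by
  have hH : (Aᵀ * A).IsHermitian := by
    simpa [conjTranspose_eq_transpose_of_trivial] using isHermitian_conjTranspose_mul_self A
  obtain ⟨G, hGT, h1, h2, h3⟩ : ∃ G : Matrix (Fin p) (Fin p) ℝ, Gᵀ = G ∧
      (Aᵀ * A) * G * (Aᵀ * A) = Aᵀ * A ∧ G * (Aᵀ * A) * G = G ∧
      (Aᵀ * A) * G = G * (Aᵀ * A) := by
    set U : Matrix (Fin p) (Fin p) ℝ := (hH.eigenvectorUnitary : Matrix (Fin p) (Fin p) ℝ)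
    set D : Matrix (Fin p) (Fin p) ℝ := diagonal hH.eigenvalues
    set E : Matrix (Fin p) (Fin p) ℝ := diagonal (fun k => (hH.eigenvalues k)⁻¹)
    have hU : Uᵀ * U = 1 := by
      have := Unitary.coe_star_mul_self hH.eigenvectorUnitary
      simpa [star_eq_conjTranspose, conjTranspose_eq_transpose_of_trivial] using this
    have hS : Aᵀ * A = U * D * Uᵀ := by
      have := hH.spectral_theorem
      simpa [Unitary.conjStarAlgAut_apply, star_eq_conjTranspose,
        conjTranspose_eq_transpose_of_trivial] using this
    have hc : ∀ X Y : Matrix (Fin p) (Fin p) ℝ,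
        (U * X * Uᵀ) * (U * Y * Uᵀ) = U * (X * Y) * Uᵀ := by
      intro X Y
      calc (U * X * Uᵀ) * (U * Y * Uᵀ) = U * X * (Uᵀ * U) * Y * Uᵀ := by
            simp only [Matrix.mul_assoc]
        _ = U * (X * Y) * Uᵀ := by rw [hU]; simp only [Matrix.mul_assoc, Matrix.one_mul]
    refine ⟨U * E * Uᵀ, ?_, ?_, ?_, ?_⟩
    · simp [E, transpose_mul, Matrix.mul_assoc]
    · rw [hS, hc, hc]
      simp [D, E, diagonal_mul_diagonal]
    · rw [hS, hc, hc]
      have : (fun k => (hH.eigenvalues k)⁻¹ * hH.eigenvalues k * (hH.eigenvalues k)⁻¹) =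
          fun k => (hH.eigenvalues k)⁻¹ := by
        funext k
        by_cases h : hH.eigenvalues k = 0 <;> simp [h]
      simp only [D, E, diagonal_mul_diagonal, this]
    · rw [hS, hc, hc]
      simp [D, E, diagonal_mul_diagonal, mul_comm]
  refine ⟨G * Aᵀ, ?_, ?_, ?_, ?_⟩
  · have h : (A * (G * Aᵀ) * A - A)ᵀ * (A * (G * Aᵀ) * A - A) = 0 := by
      have e1 : A * (G * Aᵀ) * A - A = A * (G * (Aᵀ * A) - 1) := by
        simp only [Matrix.mul_sub, Matrix.mul_assoc, Matrix.mul_one]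
      rw [e1, transpose_mul]
      have e2 : Aᵀ * (A * (G * (Aᵀ * A) - 1)) = 0 := by
        have : Aᵀ * (A * (G * (Aᵀ * A) - 1)) = (Aᵀ * A) * G * (Aᵀ * A) - Aᵀ * A := by
          simp only [Matrix.mul_sub, Matrix.mul_assoc, Matrix.mul_one]
        rw [this, h1, sub_self]
      rw [Matrix.mul_assoc, e2, Matrix.mul_zero]
    have := conjTranspose_mul_self_eq_zero.1
      (by simpa [conjTranspose_eq_transpose_of_trivial] using h :
        (A * (G * Aᵀ) * A - A)ᴴ * (A * (G * Aᵀ) * A - A) = 0)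
    exact sub_eq_zero.1 this
  · calc G * Aᵀ * A * (G * Aᵀ) = (G * (Aᵀ * A) * G) * Aᵀ := by simp only [Matrix.mul_assoc]
      _ = G * Aᵀ := by rw [h2]
  · simp [transpose_mul, hGT, Matrix.mul_assoc]
  · have : G * Aᵀ * A = G * (Aᵀ * A) := by simp only [Matrix.mul_assoc]
    rw [this, transpose_mul, hGT, transpose_mul, transpose_transpose, h3]

/-- The Penrose equations have at most one solution. -/
theorem IsMoorePenrose.unique {n p : ℕ} {A : Matrix (Fin n) (Fin p) ℝ}
    {B C : Matrix (Fin p) (Fin n) ℝ} (hB : IsMoorePenrose A B) (hC : IsMoorePenrose A C) :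
    B = C := by
  have h1 : A * B = A * C := by
    calc A * B = (A * C * A) * B := by rw [hC.mul_mul_left]
      _ = (A * C)ᵀ * (A * B)ᵀ := by
          rw [hC.symm_left, hB.symm_left]; simp only [Matrix.mul_assoc]
      _ = (A * B * A * C)ᵀ := by rw [← transpose_mul]; simp only [Matrix.mul_assoc]
      _ = A * C := by rw [hB.mul_mul_left, hC.symm_left]
  have h2 : B * A = C * A := by
    calc B * A = B * (A * C * A) := by rw [hC.mul_mul_left]
      _ = (B * A)ᵀ * (C * A)ᵀ := by
          rw [hC.symm_right, hB.symm_right]; simp only [Matrix.mul_assoc]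
      _ = (C * (A * B * A))ᵀ := by rw [← transpose_mul]; simp only [Matrix.mul_assoc]
      _ = C * A := by rw [hB.mul_mul_left, hC.symm_right]
  calc B = B * A * B := hB.mul_mul_right.symm
    _ = C * (A * B) := by rw [h2, Matrix.mul_assoc]
    _ = C := by rw [h1, ← Matrix.mul_assoc, hC.mul_mul_right]

/-- The Moore–Penrose inverse `A†`. -/
def pinv {n p : ℕ} (A : Matrix (Fin n) (Fin p) ℝ) : Matrix (Fin p) (Fin n) ℝ :=
  (exists_isMoorePenrose A).choose

theorem pinv_spec {n p : ℕ} (A : Matrix (Fin n) (Fin p) ℝ) : IsMoorePenrose A (pinv A) :=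
  (exists_isMoorePenrose A).choose_spec

/-! ### Views of an agent

A view is a bijection `e : Fin p ⊕ Fin q ≃ Fin d`: the agent sees the `p` coordinates
`e (inl a)` and does not see the `q = d - p` coordinates `e (inr b)`. -/

section View

variable {d p q : ℕ} (e : Fin p ⊕ Fin q ≃ Fin d)

/-- The permutation matrix `Π`, with the rows of `Π₊` above the rows of `Π₋`. -/
def permMat : Matrix (Fin p ⊕ Fin q) (Fin d) ℝ :=
  Matrix.of fun a k => if e a = k then 1 else 0

/-- `Π₊`, the rows of `Π` for the observed coordinates. -/
def seen : Matrix (Fin p) (Fin d) ℝ := (permMat e).toRows₁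

/-- `Π₋`, the rows of `Π` for the unobserved coordinates. -/
def unseen : Matrix (Fin q) (Fin d) ℝ := (permMat e).toRows₂

/-- `S₊ = Π₊ S Π₊ᵀ`. -/
def blockPlus (S : Matrix (Fin d) (Fin d) ℝ) : Matrix (Fin p) (Fin p) ℝ :=
  seen e * S * (seen e)ᵀ

/-- `S± = Π₊ S Π₋ᵀ`. -/
def blockPlusMinus (S : Matrix (Fin d) (Fin d) ℝ) : Matrix (Fin p) (Fin q) ℝ :=
  seen e * S * (unseen e)ᵀ

/-- `S∓ = Π₋ S Π₊ᵀ`. -/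
def blockMinusPlus (S : Matrix (Fin d) (Fin d) ℝ) : Matrix (Fin q) (Fin p) ℝ :=
  unseen e * S * (seen e)ᵀ

/-- `T = [ I   S₊⁻¹ S± ] Π`. -/
def T (S : Matrix (Fin d) (Fin d) ℝ) : Matrix (Fin p) (Fin d) ℝ :=
  Matrix.fromCols (1 : Matrix (Fin p) (Fin p) ℝ) ((blockPlus e S)⁻¹ * blockPlusMinus e S) *
    permMat e

/-- `z₊ = x₋ - S∓ S₊⁻¹ x₊`. -/
def residual (S : Matrix (Fin d) (Fin d) ℝ) (x : Fin d → ℝ) : Fin q → ℝ :=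
  unseen e *ᵥ x - (blockMinusPlus e S * (blockPlus e S)⁻¹) *ᵥ (seen e *ᵥ x)

/-- The local least squares estimate `X₊† y`, where `X₊ = X Π₊ᵀ`. -/
def localOLS {n : ℕ} (X : Matrix (Fin n) (Fin d) ℝ) (y : Fin n → ℝ) : Fin p → ℝ :=
  pinv (X * (seen e)ᵀ) *ᵥ y

end View

/-! ### Population quantities -/

/-- The covariance matrix of a distribution `P` on `ℝᵈ`. -/
def covMat {d : ℕ} (P : Measure (Fin d → ℝ)) : Matrix (Fin d) (Fin d) ℝ :=
  Matrix.of fun k l => cov[fun x => x k, fun x => x l; P]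

/-- The matrix `E[x₊ θ₋ᵀ z₊ z₊ᵀ θ₋ x₊ᵀ]`, with `x ∼ P`. -/
def crossMoment {d p q : ℕ} (e : Fin p ⊕ Fin q ≃ Fin d) (P : Measure (Fin d → ℝ))
    (θ : Fin d → ℝ) : Matrix (Fin p) (Fin p) ℝ :=
  Matrix.of fun k l => ∫ x,
    (seen e *ᵥ x) k * ((unseen e *ᵥ θ) ⬝ᵥ residual e (covMat P) x) *
      (residual e (covMat P) x ⬝ᵥ (unseen e *ᵥ θ)) * (seen e *ᵥ x) l ∂P

/-- `W⋆ = Σ₊ (E[x₊ θ₋ᵀ z₊ z₊ᵀ θ₋ x₊ᵀ] + σ² Σ₊)⁻¹ Σ₊`. -/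
def optWeight {d p q : ℕ} (e : Fin p ⊕ Fin q ≃ Fin d) (P : Measure (Fin d → ℝ))
    (θ : Fin d → ℝ) (σ : ℝ) : Matrix (Fin p) (Fin p) ℝ :=
  blockPlus e (covMat P) *
    (crossMoment e P θ + σ ^ 2 • blockPlus e (covMat P))⁻¹ *
    blockPlus e (covMat P)

/-! ### Weighted aggregation -/

section Aggregation

variable {m d : ℕ} {p q : Fin m → ℕ} (e : ∀ i, Fin (p i) ⊕ Fin (q i) ≃ Fin d)
  (S : Matrix (Fin d) (Fin d) ℝ) (W : ∀ i, Matrix (Fin (p i)) (Fin (p i)) ℝ)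
  (θloc : ∀ i, Fin (p i) → ℝ)

/-- The objective `t ↦ ∑ᵢ ‖t₊ + S₊⁻¹ S± t₋ - θlocᵢ‖²` with the squared norm `v ↦ vᵀ Wᵢ v`. -/
def aggObjective (t : Fin d → ℝ) : ℝ :=
  ∑ i, (seen (e i) *ᵥ t +
      ((blockPlus (e i) S)⁻¹ * blockPlusMinus (e i) S) *ᵥ (unseen (e i) *ᵥ t) - θloc i) ⬝ᵥ
    (W i *ᵥ (seen (e i) *ᵥ t +
      ((blockPlus (e i) S)⁻¹ * blockPlusMinus (e i) S) *ᵥ (unseen (e i) *ᵥ t) - θloc i))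

/-- The weighted aggregation: a minimizer of the objective over `ℝᵈ`. -/
def aggregate : Fin d → ℝ :=
  Classical.epsilon fun t => IsMinOn (aggObjective e S W θloc) Set.univ t

end Aggregation

/-! ### Data -/

/-- The data matrix whose rows are the first `n` feature vectors. -/
def dataMat {d : ℕ} (n : ℕ) (x : ℕ → Fin d → ℝ) : Matrix (Fin n) (Fin d) ℝ :=
  Matrix.of fun j k => x j k

/-- The labels `y = X θ + ξ` of the first `n` samples. -/
def labels {d : ℕ} (n : ℕ) (θ : Fin d → ℝ) (x : ℕ → Fin d → ℝ) (ξ : ℕ → ℝ) : Fin n → ℝ :=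
  fun j => (dataMat n x *ᵥ θ) j + ξ j

/-- The local estimates of the agents from `n` samples each. -/
def localEstimates {m d : ℕ} {p q : Fin m → ℕ} (e : ∀ i, Fin (p i) ⊕ Fin (q i) ≃ Fin d)
    (θ : Fin d → ℝ) (n : ℕ) (x : Fin m → ℕ → Fin d → ℝ) (ξ : Fin m → ℕ → ℝ)
    (i : Fin m) : Fin (p i) → ℝ :=
  localOLS (e i) (dataMat n (x i)) (labels n θ (x i) (ξ i))

end Collab

end

namespace Collab

open scoped Topology

/-! ### Coordinates of a view and the best linear prediction from the seen features. -/

section View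

variable {d p q : ℕ} (e : Fin p ⊕ Fin q ≃ Fin d)

/-! Regressing `x ⬝ᵥ θ` on the seen features gives `x₊ ⬝ᵥ Tθ` plus a residual uncorrelated with `x₊`
(`dotProduct_eq_seen_add_residual`, `integral_seen_mul_residual`). So an agent's least squares
estimates `Tθ`, and its error times `√n` is the inverse sample second moment matrix applied to a
normalized sum of centered scores `x₊ (θ₋ᵀ z₊ + ξ)` (`sqrt_smul_localOLS_sub`). By the law of large
numbers, the central limit theorem and Slutsky's theorem, the limit is Gaussian with covariance `V =
Σ₊⁻¹ Q Σ₊⁻¹`, where `Q` is the covariance of the score. The optimal weight is exactly `V⁻¹`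
(`inv_localCov`).

The objective is `∑ᵢ (Tᵢ t - θlocᵢ)ᵀ Wᵢ (Tᵢ t - θlocᵢ)`, a weighted least squares problem that is
strictly convex because every feature is seen (`infoMat_posDef`). Its minimizer is `∑ᵢ Gᵢ θlocᵢ`
with `∑ᵢ Gᵢ Tᵢ = 1`. Agents are independent, so the limit covariance is `C(W) = ∑ᵢ Gᵢ Vᵢ Gᵢᵀ`, and
the Gauss–Markov identity `sum_mul_mul_transpose_sub_inv` bounds it below by `(∑ᵢ Tᵢᵀ Vᵢ⁻¹ Tᵢ)⁻¹`,
with equality at `Wᵢ = Vᵢ⁻¹`. -/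

theorem seen_mulVec (v : Fin d → ℝ) (a : Fin p) : (seen e *ᵥ v) a = v (e (Sum.inl a)) := by
  simp [seen, permMat, mulVec, dotProduct, toRows₁]

theorem unseen_mulVec (v : Fin d → ℝ) (b : Fin q) : (unseen e *ᵥ v) b = v (e (Sum.inr b)) := by
  simp [unseen, permMat, mulVec, dotProduct, toRows₂]

theorem mul_seen_transpose {n : Type*} (A : Matrix n (Fin d) ℝ) :
    A * (seen e)ᵀ = A.submatrix id (fun a => e (Sum.inl a)) := by
  ext j a
  simp [seen, permMat, Matrix.mul_apply, toRows₁]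

theorem mul_unseen_transpose {n : Type*} (A : Matrix n (Fin d) ℝ) :
    A * (unseen e)ᵀ = A.submatrix id (fun b => e (Sum.inr b)) := by
  ext j a
  simp [unseen, permMat, Matrix.mul_apply, toRows₂]

theorem seen_mul {n : Type*} (A : Matrix (Fin d) n ℝ) :
    seen e * A = A.submatrix (fun a => e (Sum.inl a)) id := by
  ext j a
  simp [seen, permMat, Matrix.mul_apply, toRows₁]

theorem unseen_mul {n : Type*} (A : Matrix (Fin d) n ℝ) :
    unseen e * A = A.submatrix (fun b => e (Sum.inr b)) id := by
  ext j a
  simp [unseen, permMat, Matrix.mul_apply, toRows₂]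

theorem blockPlus_apply (S : Matrix (Fin d) (Fin d) ℝ) (a b : Fin p) :
    blockPlus e S a b = S (e (Sum.inl a)) (e (Sum.inl b)) := by
  simp [blockPlus, seen_mul, mul_seen_transpose]

theorem blockPlusMinus_apply (S : Matrix (Fin d) (Fin d) ℝ) (a : Fin p) (b : Fin q) :
    blockPlusMinus e S a b = S (e (Sum.inl a)) (e (Sum.inr b)) := by
  simp [blockPlusMinus, seen_mul, mul_unseen_transpose]

theorem blockMinusPlus_apply (S : Matrix (Fin d) (Fin d) ℝ) (b : Fin q) (a : Fin p) :
    blockMinusPlus e S b a = S (e (Sum.inr b)) (e (Sum.inl a)) := by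
  simp [blockMinusPlus, unseen_mul, mul_seen_transpose]

theorem sum_view (f : Fin d → ℝ) :
    ∑ k, f k = ∑ a, f (e (Sum.inl a)) + ∑ b, f (e (Sum.inr b)) := by
  rw [← e.sum_comp, Fintype.sum_sum_type]

theorem T_mulVec (S : Matrix (Fin d) (Fin d) ℝ) (t : Fin d → ℝ) :
    T e S *ᵥ t = seen e *ᵥ t +
      ((blockPlus e S)⁻¹ * blockPlusMinus e S) *ᵥ (unseen e *ᵥ t) := by
  have h : permMat e *ᵥ t = Sum.elim (seen e *ᵥ t) (unseen e *ᵥ t) := by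
    ext (a | b)
    · rfl
    · rfl
  rw [T, ← mulVec_mulVec, h, fromCols_mulVec]
  simp

variable {S : Matrix (Fin d) (Fin d) ℝ}

theorem blockPlus_posDef (hS : S.PosDef) : (blockPlus e S).PosDef := by
  have : blockPlus e S = S.submatrix (fun a => e (Sum.inl a)) (fun a => e (Sum.inl a)) := by
    ext a b
    exact blockPlus_apply e S a b
  rw [this]
  exact hS.submatrix (e.injective.comp Sum.inl_injective)

/-- Multiplying by `S₊` cancels the inverse in `T` and leaves the seen rows `[S₊ S±]` of `S`. These
normal equations yield both the definiteness of the aggregation problem and the uncorrelatedness of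
the residual. -/
theorem blockPlus_mulVec_T_mulVec (hS : S.PosDef) (t : Fin d → ℝ) :
    blockPlus e S *ᵥ (T e S *ᵥ t) = seen e *ᵥ (S *ᵥ t) := by
  have hu : IsUnit (blockPlus e S).det :=
    (Matrix.isUnit_iff_isUnit_det _).1 (blockPlus_posDef e hS).isUnit
  rw [T_mulVec, mulVec_add, mulVec_mulVec _ (blockPlus e S) (_ * _),
    mul_nonsing_inv_cancel_left _ _ hu]
  ext a
  rw [seen_mulVec, Pi.add_apply]
  simp only [mulVec, dotProduct, blockPlus_apply, blockPlusMinus_apply]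
  rw [sum_view e]
  congr 1
  · exact Finset.sum_congr rfl fun b _ => congrArg _ (seen_mulVec e t b)
  · exact Finset.sum_congr rfl fun b _ => congrArg _ (unseen_mulVec e t b)

theorem blockMinusPlus_eq_transpose (hS : S.IsSymm) :
    blockMinusPlus e S = (blockPlusMinus e S)ᵀ := by
  ext b a
  rw [transpose_apply, blockMinusPlus_apply, blockPlusMinus_apply, hS.apply]

theorem blockPlus_isSymm (hS : S.IsSymm) : (blockPlus e S).IsSymm := by
  ext b a
  rw [transpose_apply, blockPlus_apply, blockPlus_apply, hS.apply]

/-- The best linear prediction of `x ⬝ᵥ θ` from the seen features, plus its residual. -/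
theorem dotProduct_eq_seen_add_residual (hS : S.IsSymm) (x θ : Fin d → ℝ) :
    x ⬝ᵥ θ = (seen e *ᵥ x) ⬝ᵥ (T e S *ᵥ θ) + (unseen e *ᵥ θ) ⬝ᵥ residual e S x := by
  have h1 : x ⬝ᵥ θ = (seen e *ᵥ x) ⬝ᵥ (seen e *ᵥ θ) + (unseen e *ᵥ θ) ⬝ᵥ (unseen e *ᵥ x) := by
    simp only [dotProduct, seen_mulVec, unseen_mulVec]
    rw [sum_view e]
    simp only [mul_comm]
  -- By symmetry of `S`, the regression matrix `S∓ S₊⁻¹` is the transpose of `S₊⁻¹ S±`, so it can be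
  -- moved from `x₊` to `θ₋`.
  have h2 : (unseen e *ᵥ θ) ⬝ᵥ ((blockMinusPlus e S * (blockPlus e S)⁻¹) *ᵥ (seen e *ᵥ x)) =
      (seen e *ᵥ x) ⬝ᵥ (((blockPlus e S)⁻¹ * blockPlusMinus e S) *ᵥ (unseen e *ᵥ θ)) := by
    rw [dotProduct_mulVec, ← mulVec_transpose, transpose_mul, transpose_nonsing_inv,
      blockPlus_isSymm e hS, blockMinusPlus_eq_transpose e hS, transpose_transpose,
      dotProduct_comm]
  rw [h1, residual, T_mulVec, dotProduct_add, dotProduct_sub, h2]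
  ring

end View

/-! ### Aggregation as weighted least squares. -/

theorem isMinOn_quadratic_iff {n : Type*} [Fintype n] [DecidableEq n] {H : Matrix n n ℝ}
    (hH : H.PosDef) (b : n → ℝ) (c : ℝ) (t : n → ℝ) :
    IsMinOn (fun s => s ⬝ᵥ (H *ᵥ s) - 2 * (b ⬝ᵥ s) + c) Set.univ t ↔ t = H⁻¹ *ᵥ b := by
  have hu : IsUnit H.det := (Matrix.isUnit_iff_isUnit_det _).1 hH.isUnit
  have hsymm : Hᵀ = H := by
    simpa [IsHermitian, conjTranspose_eq_transpose_of_trivial] using hH.isHermitian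
  set t₀ := H⁻¹ *ᵥ b with ht₀
  have hb : H *ᵥ t₀ = b := by rw [ht₀, mulVec_mulVec, mul_nonsing_inv _ hu, one_mulVec]
  -- Completing the square at the critical point `t₀`.
  have key : ∀ s, s ⬝ᵥ (H *ᵥ s) - 2 * (b ⬝ᵥ s) + c =
      (t₀ ⬝ᵥ (H *ᵥ t₀) - 2 * (b ⬝ᵥ t₀) + c) + (s - t₀) ⬝ᵥ (H *ᵥ (s - t₀)) := by
    intro s
    have h1 : t₀ ⬝ᵥ (H *ᵥ s) = b ⬝ᵥ s := by
      rw [dotProduct_mulVec, ← mulVec_transpose, hsymm, hb]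
    rw [mulVec_sub, sub_dotProduct, dotProduct_sub, dotProduct_sub, h1, hb,
      dotProduct_comm s b, dotProduct_comm t₀ b]
    ring
  have hnn : ∀ v : n → ℝ, 0 ≤ v ⬝ᵥ (H *ᵥ v) := fun v => by
    simpa using hH.posSemidef.dotProduct_mulVec_nonneg v
  constructor
  · intro h
    by_contra hne
    have h1 := h (Set.mem_univ t₀)
    have h2 : 0 < (t - t₀) ⬝ᵥ (H *ᵥ (t - t₀)) := by
      simpa using hH.dotProduct_mulVec_pos (sub_ne_zero.2 hne)
    simp only [Set.mem_ofPred_eq] at h1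
    rw [key t] at h1
    linarith
  · rintro rfl s -
    simp only [Set.mem_ofPred_eq]
    rw [key s]
    linarith [hnn (s - t₀)]

section Aggregation

variable {m d : ℕ} {p q : Fin m → ℕ} (e : ∀ i, Fin (p i) ⊕ Fin (q i) ≃ Fin d)
  (S : Matrix (Fin d) (Fin d) ℝ) (W : ∀ i, Matrix (Fin (p i)) (Fin (p i)) ℝ)

/-- The matrix `∑ᵢ Tᵢᵀ Wᵢ Tᵢ` of the quadratic part of the objective. -/
noncomputable def infoMat : Matrix (Fin d) (Fin d) ℝ :=
  ∑ i, (T (e i) S)ᵀ * W i * T (e i) S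

/-- The matrix by which the local estimate of agent `i` enters the aggregation. -/
noncomputable def gain (i : Fin m) : Matrix (Fin d) (Fin (p i)) ℝ :=
  (infoMat e S W)⁻¹ * ((T (e i) S)ᵀ * W i)

variable {S W}

/-- If every `Tᵢ t` vanishes, then `S₊ T = Π₊ S` shows that each seen coordinate of `S t` vanishes.
Since every coordinate is seen by someone, `S t = 0` and hence `t = 0`. The proof runs this for a
single nonzero coordinate of `S t`. -/
theorem infoMat_posDef (hcover : ∀ k : Fin d, ∃ (i : Fin m) (a : Fin (p i)), e i (Sum.inl a) = k)
    (hS : S.PosDef) (hW : ∀ i, (W i).PosDef) : (infoMat e S W).PosDef := by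
  have hnn : ∀ i, ((T (e i) S)ᵀ * W i * T (e i) S).PosSemidef := fun i => by
    simpa [conjTranspose_eq_transpose_of_trivial] using
      (hW i).posSemidef.conjTranspose_mul_mul_same (T (e i) S)
  refine PosDef.of_dotProduct_mulVec_pos (posSemidef_sum _ fun i _ => hnn i).isHermitian ?_
  intro t ht
  have hq : ∀ i, star t ⬝ᵥ (((T (e i) S)ᵀ * W i * T (e i) S) *ᵥ t) =
      star (T (e i) S *ᵥ t) ⬝ᵥ (W i *ᵥ (T (e i) S *ᵥ t)) := fun i => by
    rw [← mulVec_mulVec, ← mulVec_mulVec, dotProduct_mulVec, vecMul_transpose]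
    simp
  rw [infoMat, sum_mulVec, dotProduct_sum]
  refine Finset.sum_pos' (fun i _ => (hnn i).dotProduct_mulVec_nonneg t) ?_
  have hSt : S *ᵥ t ≠ 0 := fun h => by
    have := hS.dotProduct_mulVec_pos ht
    simp [h] at this
  obtain ⟨k, hk⟩ := Function.ne_iff.1 hSt
  obtain ⟨i, a, rfl⟩ := hcover k
  refine ⟨i, Finset.mem_univ _, ?_⟩
  rw [hq]
  refine (hW i).dotProduct_mulVec_pos fun h => hk ?_
  have := congrFun (blockPlus_mulVec_T_mulVec (e i) hS t) a
  rw [h, mulVec_zero, seen_mulVec] at this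
  exact this.symm

theorem aggObjective_eq (θloc : ∀ i, Fin (p i) → ℝ) (hW : ∀ i, (W i)ᵀ = W i) (t : Fin d → ℝ) :
    aggObjective e S W θloc t = t ⬝ᵥ (infoMat e S W *ᵥ t) -
      2 * ((∑ i, ((T (e i) S)ᵀ * W i) *ᵥ θloc i) ⬝ᵥ t) + ∑ i, θloc i ⬝ᵥ (W i *ᵥ θloc i) := by
  rw [infoMat, sum_mulVec, dotProduct_sum, sum_dotProduct, Finset.mul_sum,
    ← Finset.sum_sub_distrib, ← Finset.sum_add_distrib, aggObjective]
  refine Finset.sum_congr rfl fun i _ => ?_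
  rw [← T_mulVec]
  set u := T (e i) S *ᵥ t with hu
  have h1 : t ⬝ᵥ (((T (e i) S)ᵀ * W i * T (e i) S) *ᵥ t) = u ⬝ᵥ (W i *ᵥ u) := by
    rw [← mulVec_mulVec, ← mulVec_mulVec, dotProduct_mulVec, vecMul_transpose]
  have h2 : (((T (e i) S)ᵀ * W i) *ᵥ θloc i) ⬝ᵥ t = u ⬝ᵥ (W i *ᵥ θloc i) := by
    rw [dotProduct_comm, ← mulVec_mulVec, dotProduct_mulVec, vecMul_transpose]
  have h3 : θloc i ⬝ᵥ (W i *ᵥ u) = u ⬝ᵥ (W i *ᵥ θloc i) := by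
    rw [dotProduct_mulVec, ← mulVec_transpose, hW i, dotProduct_comm]
  rw [h1, h2, mulVec_sub, sub_dotProduct, dotProduct_sub, dotProduct_sub, h3]
  ring

theorem isMinOn_aggObjective_iff (hH : (infoMat e S W).PosDef) (hW : ∀ i, (W i).PosDef)
    (θloc : ∀ i, Fin (p i) → ℝ) (t : Fin d → ℝ) :
    IsMinOn (aggObjective e S W θloc) Set.univ t ↔ t = ∑ i, gain e S W i *ᵥ θloc i := by
  have hW' : ∀ i, (W i)ᵀ = W i := fun i => by
    simpa [IsHermitian, conjTranspose_eq_transpose_of_trivial] using (hW i).isHermitian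
  rw [show aggObjective e S W θloc = _ from funext (aggObjective_eq e θloc hW'),
    isMinOn_quadratic_iff hH]
  simp only [gain, mulVec_sum, mulVec_mulVec]

theorem aggregate_eq (hH : (infoMat e S W).PosDef) (hW : ∀ i, (W i).PosDef)
    (θloc : ∀ i, Fin (p i) → ℝ) :
    aggregate e S W θloc = ∑ i, gain e S W i *ᵥ θloc i := by
  have h := fun t => isMinOn_aggObjective_iff e hH hW θloc t
  exact (h _).1 (Classical.epsilon_spec (p := fun t => IsMinOn (aggObjective e S W θloc) Set.univ t)
    ⟨_, (h _).2 rfl⟩)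

/-- Unbiasedness: exact local values `Tᵢ θ` are aggregated to `θ`. This is the constraint in
Gauss–Markov, and it also centers the aggregated error. -/
theorem sum_gain_mul_T (hH : (infoMat e S W).PosDef) :
    ∑ i, gain e S W i * T (e i) S = 1 := by
  have hu : IsUnit (infoMat e S W).det := (Matrix.isUnit_iff_isUnit_det _).1 hH.isUnit
  simp only [gain, Matrix.mul_assoc]
  rw [← Matrix.mul_sum]
  simp only [← Matrix.mul_assoc]
  exact nonsing_inv_mul _ hu

end Aggregation

/-! ### The Gauss–Markov identity. -/

section GaussMarkov

variable {ι n : Type*} [Fintype ι] [Fintype n] [DecidableEq n] {k : ι → Type*}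
  [∀ i, Fintype (k i)] [∀ i, DecidableEq (k i)]
  {A : ∀ i, Matrix (k i) n ℝ} {V : ∀ i, Matrix (k i) (k i) ℝ} {G : ∀ i, Matrix n (k i) ℝ}

/-- Expanding the squares, the cross terms depend on `G` only through `G i * A i`, so the constraint
makes each of them sum to `K⁻¹`. An identity rather than an inequality is kept because it also
settles the case of equality, where all squares vanish. -/
theorem sum_mul_mul_transpose_sub_inv (hV : ∀ i, (V i).PosDef)
    (hK : (∑ i, (A i)ᵀ * (V i)⁻¹ * A i).PosDef) (hG : ∑ i, G i * A i = 1) :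
    ∑ i, G i * V i * (G i)ᵀ - (∑ i, (A i)ᵀ * (V i)⁻¹ * A i)⁻¹ =
      ∑ i, (G i - (∑ i, (A i)ᵀ * (V i)⁻¹ * A i)⁻¹ * ((A i)ᵀ * (V i)⁻¹)) * V i *
        (G i - (∑ i, (A i)ᵀ * (V i)⁻¹ * A i)⁻¹ * ((A i)ᵀ * (V i)⁻¹))ᵀ := by
  set K := ∑ i, (A i)ᵀ * (V i)⁻¹ * A i with hKdef
  have hKu : IsUnit K.det := (Matrix.isUnit_iff_isUnit_det _).1 hK.isUnit
  have hKs : (K⁻¹)ᵀ = K⁻¹ := by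
    rw [transpose_nonsing_inv]
    congr 1
    simpa [IsHermitian, conjTranspose_eq_transpose_of_trivial] using hK.isHermitian
  have hterm : ∀ i, (G i - K⁻¹ * ((A i)ᵀ * (V i)⁻¹)) * V i *
      (G i - K⁻¹ * ((A i)ᵀ * (V i)⁻¹))ᵀ = G i * V i * (G i)ᵀ - (G i * A i) * K⁻¹ -
        K⁻¹ * (G i * A i)ᵀ + K⁻¹ * ((A i)ᵀ * (V i)⁻¹ * A i) * K⁻¹ := by
    intro i
    have hu : IsUnit (V i).det := (Matrix.isUnit_iff_isUnit_det _).1 (hV i).isUnit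
    have hs : ((V i)⁻¹)ᵀ = (V i)⁻¹ := by
      rw [transpose_nonsing_inv]
      congr 1
      simpa [IsHermitian, conjTranspose_eq_transpose_of_trivial] using (hV i).isHermitian
    have h1 : V i * ((V i)⁻¹ * (A i * K⁻¹)) = A i * K⁻¹ := mul_nonsing_inv_cancel_left _ _ hu
    have h2 : ∀ B : Matrix (k i) n ℝ, (V i)⁻¹ * (V i * B) = B :=
      fun B => nonsing_inv_mul_cancel_left _ _ hu
    simp only [transpose_sub, transpose_mul, transpose_transpose, hs, hKs, Matrix.sub_mul,
      Matrix.mul_sub, Matrix.mul_assoc, h1, h2]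
    abel
  simp only [hterm, Finset.sum_add_distrib, Finset.sum_sub_distrib]
  rw [← Matrix.sum_mul, ← Matrix.mul_sum, ← transpose_sum, hG, ← Matrix.sum_mul, ← Matrix.mul_sum,
    ← hKdef, nonsing_inv_mul _ hKu]
  simp

/-- **Gauss–Markov**: among the linear unbiased combinations, generalized least squares has the
smallest covariance matrix. -/
theorem posSemidef_sum_mul_mul_transpose_sub_inv (hV : ∀ i, (V i).PosDef)
    (hK : (∑ i, (A i)ᵀ * (V i)⁻¹ * A i).PosDef) (hG : ∑ i, G i * A i = 1) :
    (∑ i, G i * V i * (G i)ᵀ - (∑ i, (A i)ᵀ * (V i)⁻¹ * A i)⁻¹).PosSemidef := by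
  rw [sum_mul_mul_transpose_sub_inv hV hK hG]
  refine posSemidef_sum _ fun i _ => ?_
  simpa [conjTranspose_eq_transpose_of_trivial] using
    (hV i).posSemidef.mul_mul_conjTranspose_same
      (G i - (∑ i, (A i)ᵀ * (V i)⁻¹ * A i)⁻¹ * ((A i)ᵀ * (V i)⁻¹))

end GaussMarkov

/-! ### Product laws, the multivariate central limit theorem and Gaussian images. -/

section Probability

variable {Ω : Type*} [MeasurableSpace Ω] {μ : Measure Ω} {ι κ : Type*}

/-- Independent random variables indexed by pairs, collected along the second index. -/
theorem iIndepFun_curry [IsProbabilityMeasure μ] [Countable ι] [Countable κ] {𝓧 : Type*} [MeasurableSpace 𝓧]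
    {X : ι → κ → Ω → 𝓧} (hX : ∀ j i, AEMeasurable (X j i) μ)
    (h : iIndepFun (fun (a : ι × κ) ω => X a.1 a.2 ω) μ) :
    iIndepFun (fun j ω i => X j i ω) μ := by
  have hprob : ∀ j i, IsProbabilityMeasure (μ.map (X j i)) := fun j i =>
    Measure.isProbabilityMeasure_map (hX j i)
  have hrow : ∀ j, AEMeasurable (fun ω i => X j i ω) μ := fun j => aemeasurable_pi_iff.2 (hX j)
  have hall : AEMeasurable (fun ω (a : ι × κ) => X a.1 a.2 ω) μ :=
    aemeasurable_pi_iff.2 fun a => hX a.1 a.2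
  rw [iIndepFun_iff_map_fun_eq_infinitePi_map₀' hrow]
  have h1 : ∀ j, μ.map (fun ω i => X j i ω) = Measure.infinitePi fun i => μ.map (X j i) := fun j =>
    (h.precomp (g := fun i => (j, i)) (Prod.mk_right_injective j)).map_fun_eq_infinitePi_map₀'
      (hX j)
  have h2 := h.map_fun_eq_infinitePi_map₀' (fun a : ι × κ => hX a.1 a.2)
  simp_rw [h1]
  rw [← Measure.infinitePi_map_curry fun j i => μ.map (X j i)]
  rw [← h2, AEMeasurable.map_map_of_aemeasurable (MeasurableEquiv.measurable _).aemeasurable hall]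
  rfl

theorem identDistrib_pi [Countable κ] {𝓧 : Type*} [MeasurableSpace 𝓧]
    {X Y : κ → Ω → 𝓧} (hX : iIndepFun X μ) (hY : iIndepFun Y μ)
    (h : ∀ i, IdentDistrib (X i) (Y i) μ μ) :
    IdentDistrib (fun ω i => X i ω) (fun ω i => Y i ω) μ μ where
  aemeasurable_fst := aemeasurable_pi_iff.2 fun i => (h i).aemeasurable_fst
  aemeasurable_snd := aemeasurable_pi_iff.2 fun i => (h i).aemeasurable_snd
  map_eq := by
    rw [hX.map_fun_eq_infinitePi_map₀' fun i => (h i).aemeasurable_fst,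
      hY.map_fun_eq_infinitePi_map₀' fun i => (h i).aemeasurable_snd]
    simp_rw [fun i => (h i).map_eq]

variable [Fintype ι]

/-- The matrix of covariances of a finite family of random variables. -/
noncomputable def covOf (X : Ω → EuclideanSpace ℝ ι) (μ : Measure Ω) : Matrix ι ι ℝ :=
  Matrix.of fun k l => cov[fun ω => X ω k, fun ω => X ω l; μ]

theorem inner_eq_sum (x t : EuclideanSpace ℝ ι) : inner ℝ x t = ∑ k, t k * x k := by
  simp [PiLp.inner_apply]

theorem variance_inner_eq [IsProbabilityMeasure μ] {X : Ω → EuclideanSpace ℝ ι} (hX : ∀ k, MemLp (fun ω => X ω k) 2 μ)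
    (t : EuclideanSpace ℝ ι) :
    Var[fun ω => inner ℝ (X ω) t; μ] = t.ofLp ⬝ᵥ (covOf X μ *ᵥ t.ofLp) := by
  simp_rw [inner_eq_sum]
  rw [variance_fun_sum fun k => (hX k).const_mul (t k)]
  simp only [dotProduct, mulVec, covOf, of_apply, covariance_const_mul_left,
    covariance_const_mul_right, Finset.mul_sum]
  exact Finset.sum_congr rfl fun i _ => Finset.sum_congr rfl fun j _ => by ring

theorem covOf_posSemidef [IsProbabilityMeasure μ] {X : Ω → EuclideanSpace ℝ ι} (hX : ∀ k, MemLp (fun ω => X ω k) 2 μ) :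
    (covOf X μ).PosSemidef := by
  refine PosSemidef.of_dotProduct_mulVec_nonneg ?_ fun t => ?_
  · ext k l
    simp [covOf, covariance_comm]
  · have := variance_inner_eq hX (WithLp.toLp 2 t)
    rw [star_trivial, ← this]
    exact variance_nonneg _ _

/-- The multivariate **central limit theorem** for centered variables. -/
theorem tendstoInDistribution_inv_sqrt_smul_sum [IsProbabilityMeasure μ] [DecidableEq ι]
    {X : ℕ → Ω → EuclideanSpace ℝ ι}
    (hindep : iIndepFun X μ) (hident : ∀ j, IdentDistrib (X j) (X 0) μ μ)
    (hL2 : ∀ k, MemLp (fun ω => X 0 ω k) 2 μ) (hmean : ∀ k, ∫ ω, X 0 ω k ∂μ = 0) :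
    TendstoInDistribution (fun (n : ℕ) ω => (√n : ℝ)⁻¹ • ∑ j ∈ Finset.range n, X j ω) atTop
      (id : EuclideanSpace ℝ ι → EuclideanSpace ℝ ι) (fun _ => μ)
      (multivariateGaussian 0 (covOf (X 0) μ)) := by
  have hXm : ∀ j, AEMeasurable (X j) μ := fun j => (hident j).aemeasurable_fst
  have hSm : ∀ n : ℕ, AEMeasurable (fun ω => (√n : ℝ)⁻¹ • ∑ j ∈ Finset.range n, X j ω) μ :=
    fun n => (Finset.aemeasurable_fun_sum _ fun j _ => hXm j).const_smul (√n : ℝ)⁻¹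
  refine ⟨hSm, aemeasurable_id, ProbabilityMeasure.tendsto_iff_tendsto_charFun.2 fun t => ?_⟩
  have hφ : Measurable fun x : EuclideanSpace ℝ ι => inner ℝ x t := by fun_prop
  have hv : Var[fun ω => inner ℝ (X 0 ω) t; μ] = t.ofLp ⬝ᵥ (covOf (X 0) μ *ᵥ t.ofLp) :=
    variance_inner_eq hL2 t
  have hm : ∫ ω, inner ℝ (X 0 ω) t ∂μ = 0 := by
    simp_rw [inner_eq_sum]
    rw [integral_finsetSum _ fun k _ => ((hL2 k).integrable (by norm_num)).const_mul (t k)]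
    simp [integral_const_mul, hmean]
  have hL : MemLp (fun ω => inner ℝ (X 0 ω) t) 2 μ := by
    simp_rw [inner_eq_sum]
    exact memLp_finsetSum _ fun k _ => (hL2 k).const_mul (t k)
  -- Cramér–Wold: the scalar theorem is applied to the projection on `t`. The characteristic
  -- function of the vector at `t` is that of the projection at `1`.
  have h1 := tendstoInDistribution_inv_sqrt_mul_sum_sub (P := μ)
    (X := fun j ω => inner ℝ (X j ω) t)
    (Y := id) (P' := gaussianReal 0 Var[fun ω => inner ℝ (X 0 ω) t; μ].toNNReal)
    HasLaw.id hL (hindep.comp (fun _ x => inner ℝ x t) fun _ => hφ)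
    (fun j => (hident j).comp hφ)
  have h2 := ProbabilityMeasure.tendsto_iff_tendsto_charFun.1 h1.tendsto 1
  simp only [ProbabilityMeasure.coe_mk, Measure.map_id] at h2 ⊢
  rw [charFun_gaussianReal] at h2
  rw [charFun_multivariateGaussian (covOf_posSemidef hL2), ← hv]
  convert h2 using 1
  · funext n
    rw [charFun_apply, charFun_apply_real,
      integral_map (hSm n) (by fun_prop), integral_map (h1.forall_aemeasurable n) (by fun_prop)]
    congr 1
    funext ω
    congr 1
    simp only [hm, real_inner_smul_left, sum_inner]
    push_cast
    ring
  · congr 2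
    have : (0 : ℝ) ≤ Var[fun ω => inner ℝ (X 0 ω) t; μ] := variance_nonneg _ _
    simp [Real.coe_toNNReal _ this]

theorem multivariateGaussian_map_mulVec [DecidableEq ι] [Fintype κ] [DecidableEq κ] {S : Matrix ι ι ℝ}
    (hS : S.PosSemidef) (A : Matrix κ ι ℝ) :
    (multivariateGaussian 0 S).map (fun x => WithLp.toLp 2 (A *ᵥ x.ofLp)) =
      multivariateGaussian 0 (A * S * Aᵀ) := by
  have hA : Continuous fun x : EuclideanSpace ℝ ι => WithLp.toLp 2 (A *ᵥ x.ofLp) := by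
    fun_prop
  have hS' : (A * S * Aᵀ).PosSemidef := by
    simpa [conjTranspose_eq_transpose_of_trivial] using hS.mul_mul_conjTranspose_same A
  have := Measure.isProbabilityMeasure_map (μ := multivariateGaussian 0 S) hA.aemeasurable
  refine Measure.ext_of_charFun ?_
  funext t
  have hin : ∀ x : EuclideanSpace ℝ ι, inner ℝ (WithLp.toLp 2 (A *ᵥ x.ofLp)) t =
      inner ℝ x (WithLp.toLp 2 (Aᵀ *ᵥ t.ofLp)) := by
    intro x
    simp only [EuclideanSpace.inner_eq_star_dotProduct, star_trivial]
    rw [dotProduct_mulVec, ← mulVec_transpose]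
  rw [charFun_apply, integral_map hA.aemeasurable (by fun_prop)]
  simp_rw [hin]
  rw [← charFun_apply, charFun_multivariateGaussian hS, charFun_multivariateGaussian hS']
  congr 3
  · simp
  · norm_cast
    simp only [← mulVec_mulVec]
    rw [dotProduct_mulVec t.ofLp, ← mulVec_transpose]

end Probability

/-! ### Measurability and full-rank formula of the Moore–Penrose inverse. -/

section Pinv

theorem isClosed_isMoorePenrose {n p : ℕ} :
    IsClosed {z : (Fin n → Fin p → ℝ) × (Fin p → Fin n → ℝ) |
      IsMoorePenrose (Matrix.of z.1) (Matrix.of z.2)} := by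
  have h1 : Continuous fun z : (Fin n → Fin p → ℝ) × (Fin p → Fin n → ℝ) => Matrix.of z.1 :=
    continuous_fst
  have h2 : Continuous fun z : (Fin n → Fin p → ℝ) × (Fin p → Fin n → ℝ) => Matrix.of z.2 :=
    continuous_snd
  have heq : {z : (Fin n → Fin p → ℝ) × (Fin p → Fin n → ℝ) |
      IsMoorePenrose (Matrix.of z.1) (Matrix.of z.2)} =
      (({z | Matrix.of z.1 * Matrix.of z.2 * Matrix.of z.1 = Matrix.of z.1} ∩
        {z | Matrix.of z.2 * Matrix.of z.1 * Matrix.of z.2 = Matrix.of z.2}) ∩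
        {z | (Matrix.of z.1 * Matrix.of z.2)ᵀ = Matrix.of z.1 * Matrix.of z.2}) ∩
        {z | (Matrix.of z.2 * Matrix.of z.1)ᵀ = Matrix.of z.2 * Matrix.of z.1} := by
    ext z
    exact ⟨fun h => ⟨⟨⟨h.1, h.2⟩, h.3⟩, h.4⟩, fun h => ⟨h.1.1.1, h.1.1.2, h.1.2, h.2⟩⟩
  rw [heq]
  exact (((isClosed_eq ((h1.matrix_mul h2).matrix_mul h1) h1).inter
    (isClosed_eq ((h2.matrix_mul h1).matrix_mul h2) h2)).inter
    (isClosed_eq (h1.matrix_mul h2).matrix_transpose (h1.matrix_mul h2))).inter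
    (isClosed_eq (h2.matrix_mul h1).matrix_transpose (h2.matrix_mul h1))

/-- The Moore–Penrose inverse is Borel, because its graph is closed. -/
theorem measurable_pinv {n p : ℕ} :
    Measurable fun (A : Fin n → Fin p → ℝ) (a : Fin p) (b : Fin n) => pinv (Matrix.of A) a b := by
  intro s hs
  set g : Set ((Fin n → Fin p → ℝ) × (Fin p → Fin n → ℝ)) :=
    {z | IsMoorePenrose (Matrix.of z.1) (Matrix.of z.2)} ∩ Prod.snd ⁻¹' s with hg
  have hgm : MeasurableSet g := isClosed_isMoorePenrose.measurableSet.inter (measurable_snd hs)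
  have hinj : Set.InjOn Prod.fst g := by
    rintro ⟨A, B⟩ ⟨hB, -⟩ ⟨A', B'⟩ ⟨hB', -⟩ h
    obtain rfl : A = A' := h
    exact Prod.ext rfl (IsMoorePenrose.unique hB hB')
  -- Lusin–Souslin: an injective measurable image of a Borel set is Borel. Injectivity on the graph
  -- is uniqueness of the Penrose solution, and the image of `g` is the preimage of `s` under
  -- `pinv`.
  convert hgm.image_of_measurable_injOn measurable_fst hinj
  ext A
  constructor
  · intro h
    exact ⟨(A, fun a b => pinv (Matrix.of A) a b), ⟨pinv_spec _, h⟩, rfl⟩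
  · rintro ⟨⟨A', B⟩, ⟨hB, hs⟩, rfl⟩
    have : (fun a b => pinv (Matrix.of A') a b) = B := IsMoorePenrose.unique (pinv_spec _) hB
    rw [Set.mem_preimage, this]
    exact hs

theorem pinv_eq_of_isUnit {n p : ℕ} (A : Matrix (Fin n) (Fin p) ℝ) (h : IsUnit (Aᵀ * A).det) :
    pinv A = (Aᵀ * A)⁻¹ * Aᵀ := by
  refine (pinv_spec A).unique ⟨?_, ?_, ?_, ?_⟩
  · rw [Matrix.mul_assoc, Matrix.mul_assoc, nonsing_inv_mul _ h, Matrix.mul_one]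
  · rw [Matrix.mul_assoc _ Aᵀ A, nonsing_inv_mul _ h, Matrix.one_mul]
  · simp [transpose_mul, transpose_nonsing_inv, Matrix.mul_assoc]
  · rw [Matrix.mul_assoc _ Aᵀ A, nonsing_inv_mul _ h, transpose_one]

end Pinv

/-! ### Moments of the score. -/

section Population

variable {d p q : ℕ} (e : Fin p ⊕ Fin q ≃ Fin d) (P : Measure (Fin d → ℝ)) (θ : Fin d → ℝ)

/-- The score `x₊ (θ₋ᵀ z₊ + ξ)` of the local regression at one sample `(x, ξ)`. -/
noncomputable def score (z : (Fin d → ℝ) × ℝ) (k : Fin p) : ℝ :=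
  (seen e *ᵥ z.1) k * ((unseen e *ᵥ θ) ⬝ᵥ residual e (covMat P) z.1 + z.2)

/-- The covariance matrix of the score. -/
noncomputable def scoreCov (σ : ℝ) : Matrix (Fin p) (Fin p) ℝ :=
  crossMoment e P θ + σ ^ 2 • blockPlus e (covMat P)

variable {P}

theorem isSymm_of_posDef {n : Type*} {S : Matrix n n ℝ} (hS : S.PosDef) : S.IsSymm := by
  simpa [IsHermitian, IsSymm, conjTranspose_eq_transpose_of_trivial] using hS.isHermitian

/-- Writes the prediction error as `x ⬝ᵥ w` with a fixed vector `w`, which reduces measurability and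
its correlation with the features to linear functionals of `x`. -/
theorem unseen_dotProduct_residual (hcov : (covMat P).PosDef) (x : Fin d → ℝ) :
    (unseen e *ᵥ θ) ⬝ᵥ residual e (covMat P) x =
      x ⬝ᵥ (θ - (seen e)ᵀ *ᵥ (T e (covMat P) *ᵥ θ)) := by
  have h := dotProduct_eq_seen_add_residual e (isSymm_of_posDef hcov) x θ
  rw [dotProduct_sub, h, dotProduct_mulVec x, vecMul_transpose]
  ring

theorem measurable_score (hcov : (covMat P).PosDef) (k : Fin p) :
    Measurable fun z => score e P θ z k := by
  simp only [score, seen_mulVec, unseen_dotProduct_residual e θ hcov]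
  simp only [dotProduct]
  fun_prop

variable {θ}

/-- Each summand is a function of `x` times a function of the noise, ready for Fubini. The factor
`1` gives the first summand this shape too. -/
theorem score_mul_score (z : (Fin d → ℝ) × ℝ) (k l : Fin p) :
    score e P θ z k * score e P θ z l =
      (((seen e *ᵥ z.1) k * ((unseen e *ᵥ θ) ⬝ᵥ residual e (covMat P) z.1)) *
        ((seen e *ᵥ z.1) l * ((unseen e *ᵥ θ) ⬝ᵥ residual e (covMat P) z.1)) * 1 +
      ((seen e *ᵥ z.1) k *
        ((seen e *ᵥ z.1) l * ((unseen e *ᵥ θ) ⬝ᵥ residual e (covMat P) z.1))) * (2 * z.2)) +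
      ((seen e *ᵥ z.1) k * (seen e *ᵥ z.1) l) * z.2 ^ 2 := by
  simp only [score]
  ring

theorem memLp_seen (hP2 : ∀ k, MemLp (fun x : Fin d → ℝ => x k) 2 P) (k : Fin p) :
    MemLp (fun x : Fin d → ℝ => (seen e *ᵥ x) k) 2 P := by
  simpa only [seen_mulVec] using hP2 (e (Sum.inl k))

variable {σ : ℝ≥0}

theorem integrable_gaussianReal_sq : Integrable (fun y : ℝ => y ^ 2) (gaussianReal 0 (σ ^ 2)) := by
  simpa using (memLp_id_gaussianReal (μ := 0) (v := σ ^ 2) 2).integrable_sq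

theorem integrable_gaussianReal_id : Integrable (fun y : ℝ => y) (gaussianReal 0 (σ ^ 2)) :=
  (memLp_id_gaussianReal (μ := 0) (v := σ ^ 2) 1).integrable le_rfl

theorem integral_gaussianReal_sq : ∫ y, y ^ 2 ∂(gaussianReal 0 (σ ^ 2)) = (σ : ℝ) ^ 2 := by
  have h := variance_id_gaussianReal (μ := 0) (v := σ ^ 2)
  rw [variance_eq_integral aemeasurable_id] at h
  simpa using h

/-- Every factor in `x` is a product of two square integrable functions, either a seen feature or a
seen feature times the prediction error. Hence no further fourth moments of `x` are needed. -/
theorem integrable_score_mul_terms (hP2 : ∀ k, MemLp (fun x : Fin d → ℝ => x k) 2 P)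
    (hP4 : ∀ k : Fin p, MemLp (fun x : Fin d → ℝ =>
      (seen e *ᵥ x) k * ((unseen e *ᵥ θ) ⬝ᵥ residual e (covMat P) x)) 2 P) (k l : Fin p) :
    Integrable (fun z : (Fin d → ℝ) × ℝ =>
      (((seen e *ᵥ z.1) k * ((unseen e *ᵥ θ) ⬝ᵥ residual e (covMat P) z.1)) *
        ((seen e *ᵥ z.1) l * ((unseen e *ᵥ θ) ⬝ᵥ residual e (covMat P) z.1))) * 1)
      (P.prod (gaussianReal 0 (σ ^ 2))) ∧
    Integrable (fun z : (Fin d → ℝ) × ℝ => ((seen e *ᵥ z.1) k *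
        ((seen e *ᵥ z.1) l * ((unseen e *ᵥ θ) ⬝ᵥ residual e (covMat P) z.1))) * (2 * z.2))
      (P.prod (gaussianReal 0 (σ ^ 2))) ∧
    Integrable (fun z : (Fin d → ℝ) × ℝ => ((seen e *ᵥ z.1) k * (seen e *ᵥ z.1) l) * z.2 ^ 2)
      (P.prod (gaussianReal 0 (σ ^ 2))) := by
  have hs := memLp_seen e hP2
  exact ⟨((hP4 k).integrable_mul (hP4 l)).mul_prod (g := fun _ : ℝ => (1 : ℝ))
      (integrable_const _),
    ((hs k).integrable_mul (hP4 l)).mul_prod (g := fun y : ℝ => 2 * y)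
      (integrable_gaussianReal_id.const_mul 2),
    ((hs k).integrable_mul (hs l)).mul_prod (g := fun y : ℝ => y ^ 2)
      integrable_gaussianReal_sq⟩

/-- The cross moment has the quadratic form `E[((v ⬝ᵥ x₊) θ₋ᵀ z₊)²]`, so it is only semidefinite in
general. The noise part `σ² Σ₊` makes the sum definite. -/
theorem scoreCov_posDef (hcov : (covMat P).PosDef)
    (hP4 : ∀ k : Fin p, MemLp (fun x : Fin d → ℝ =>
      (seen e *ᵥ x) k * ((unseen e *ᵥ θ) ⬝ᵥ residual e (covMat P) x)) 2 P)
    (hσ : 0 < σ) : (scoreCov e P θ σ).PosDef := by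
  have hlin : ∀ (v : Fin p → ℝ) (x : Fin d → ℝ), ∑ k, v k * ((seen e *ᵥ x) k *
      ((unseen e *ᵥ θ) ⬝ᵥ residual e (covMat P) x)) = (v ⬝ᵥ (seen e *ᵥ x)) *
      ((unseen e *ᵥ θ) ⬝ᵥ residual e (covMat P) x) := fun v x => by
    simp only [dotProduct, Finset.sum_mul, mul_assoc]
  refine PosDef.posSemidef_add ?_ ((blockPlus_posDef e hcov).smul (by positivity))
  refine PosSemidef.of_dotProduct_mulVec_nonneg ?_ fun v => ?_
  · ext k l
    simp only [crossMoment, conjTranspose_apply, of_apply, star_trivial]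
    refine integral_congr_ae (ae_of_all _ fun x => ?_)
    simp only [dotProduct_comm (residual e (covMat P) x)]
    ring
  · have hq : star v ⬝ᵥ (crossMoment e P θ *ᵥ v) = ∫ x, ((v ⬝ᵥ (seen e *ᵥ x)) *
        ((unseen e *ᵥ θ) ⬝ᵥ residual e (covMat P) x)) ^ 2 ∂P := by
      simp_rw [← hlin v, sq, Finset.sum_mul_sum]
      have hint : ∀ k l, Integrable (fun x : Fin d → ℝ => v k * ((seen e *ᵥ x) k *
          ((unseen e *ᵥ θ) ⬝ᵥ residual e (covMat P) x)) * (v l * ((seen e *ᵥ x) l *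
          ((unseen e *ᵥ θ) ⬝ᵥ residual e (covMat P) x)))) P := fun k l =>
        ((hP4 k).const_mul (v k)).integrable_mul ((hP4 l).const_mul (v l))
      rw [integral_finsetSum _ fun k _ => integrable_finsetSum _ fun l _ => hint k l]
      rw [star_trivial, dotProduct]
      refine Finset.sum_congr rfl fun k _ => ?_
      rw [integral_finsetSum _ fun l _ => hint k l, mulVec, dotProduct, Finset.mul_sum]
      refine Finset.sum_congr rfl fun l _ => ?_
      rw [crossMoment, of_apply, ← integral_mul_const, ← integral_const_mul]
      refine integral_congr_ae (ae_of_all _ fun x => ?_)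
      simp only [dotProduct_comm (residual e (covMat P) x)]
      ring
    rw [hq]
    exact integral_nonneg fun x => sq_nonneg _

theorem memLp_score (hP2 : ∀ k, MemLp (fun x : Fin d → ℝ => x k) 2 P) (hcov : (covMat P).PosDef)
    (hP4 : ∀ k : Fin p, MemLp (fun x : Fin d → ℝ =>
      (seen e *ᵥ x) k * ((unseen e *ᵥ θ) ⬝ᵥ residual e (covMat P) x)) 2 P) (k : Fin p) :
    MemLp (fun z => score e P θ z k) 2 (P.prod (gaussianReal 0 (σ ^ 2))) := by
  rw [memLp_two_iff_integrable_sq (measurable_score e θ hcov k).aestronglyMeasurable]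
  obtain ⟨h1, h2, h3⟩ := integrable_score_mul_terms (σ := σ) e hP2 hP4 k k
  simp_rw [sq (score e P θ _ k), score_mul_score]
  exact (h1.add h2).add h3

variable [IsProbabilityMeasure P]

theorem integral_mul_eq_covMat (hP2 : ∀ k, MemLp (fun x : Fin d → ℝ => x k) 2 P)
    (hmean : ∀ k, ∫ x, x k ∂P = 0) (k l : Fin d) : ∫ x, x k * x l ∂P = covMat P k l := by
  rw [covMat, of_apply, covariance_eq_sub (hP2 k) (hP2 l), hmean]
  simp

theorem integral_mul_dotProduct (hP2 : ∀ k, MemLp (fun x : Fin d → ℝ => x k) 2 P)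
    (hmean : ∀ k, ∫ x, x k ∂P = 0) (k : Fin d) (w : Fin d → ℝ) :
    ∫ x, x k * (x ⬝ᵥ w) ∂P = (covMat P *ᵥ w) k := by
  simp only [dotProduct, Finset.mul_sum, mulVec, ← mul_assoc]
  have hint : ∀ l ∈ Finset.univ, Integrable (fun x : Fin d → ℝ => x k * x l * w l) P :=
    fun l _ => ((hP2 k).integrable_mul (hP2 l)).mul_const (w l)
  rw [integral_finsetSum _ hint]
  exact Finset.sum_congr rfl fun l _ => by
    rw [integral_mul_const, integral_mul_eq_covMat hP2 hmean]

/-- The residual is uncorrelated with the seen features. -/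
theorem integral_seen_mul_residual (hP2 : ∀ k, MemLp (fun x : Fin d → ℝ => x k) 2 P)
    (hmean : ∀ k, ∫ x, x k ∂P = 0) (hcov : (covMat P).PosDef) (a : Fin p) :
    ∫ x, (seen e *ᵥ x) a * ((unseen e *ᵥ θ) ⬝ᵥ residual e (covMat P) x) ∂P = 0 := by
  simp only [seen_mulVec, unseen_dotProduct_residual e θ hcov]
  -- The expectation is a coordinate of `Π₊ Σ (θ - Π₊ᵀ T θ)`, which vanishes since `Π₊ Σ θ = Σ₊ T θ`
  -- and `Π₊ Σ Π₊ᵀ = Σ₊`.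
  rw [integral_mul_dotProduct hP2 hmean, ← seen_mulVec e (covMat P *ᵥ _) a, mulVec_sub, mulVec_sub,
    ← blockPlus_mulVec_T_mulVec e hcov]
  simp [blockPlus, mulVec_mulVec, Matrix.mul_assoc]

theorem integral_score (hP2 : ∀ k, MemLp (fun x : Fin d → ℝ => x k) 2 P) (hmean : ∀ k, ∫ x, x k ∂P = 0)
    (hcov : (covMat P).PosDef)
    (hP4 : ∀ k : Fin p, MemLp (fun x : Fin d → ℝ =>
      (seen e *ᵥ x) k * ((unseen e *ᵥ θ) ⬝ᵥ residual e (covMat P) x)) 2 P) (k : Fin p) :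
    ∫ z, score e P θ z k ∂(P.prod (gaussianReal 0 (σ ^ 2))) = 0 := by
  have h : ∀ z : (Fin d → ℝ) × ℝ, score e P θ z k =
      ((seen e *ᵥ z.1) k * ((unseen e *ᵥ θ) ⬝ᵥ residual e (covMat P) z.1)) * 1 +
        (seen e *ᵥ z.1) k * z.2 := fun z => by
    simp only [score]
    ring
  simp_rw [h]
  rw [integral_add, integral_prod_mul (fun x : Fin d → ℝ =>
      (seen e *ᵥ x) k * ((unseen e *ᵥ θ) ⬝ᵥ residual e (covMat P) x)) fun _ : ℝ => (1 : ℝ),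
    integral_prod_mul (fun x : Fin d → ℝ => (seen e *ᵥ x) k) fun y : ℝ => y,
    integral_seen_mul_residual e hP2 hmean hcov, integral_id_gaussianReal]
  · simp
  · exact ((hP4 k).integrable one_le_two).mul_prod (g := fun _ : ℝ => (1 : ℝ))
      (integrable_const _)
  · exact ((memLp_seen e hP2 k).integrable one_le_two).mul_prod (g := fun y : ℝ => y)
      integrable_gaussianReal_id

theorem covariance_score (hP2 : ∀ k, MemLp (fun x : Fin d → ℝ => x k) 2 P) (hmean : ∀ k, ∫ x, x k ∂P = 0)
    (hcov : (covMat P).PosDef)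
    (hP4 : ∀ k : Fin p, MemLp (fun x : Fin d → ℝ =>
      (seen e *ᵥ x) k * ((unseen e *ᵥ θ) ⬝ᵥ residual e (covMat P) x)) 2 P) (k l : Fin p) :
    cov[fun z => score e P θ z k, fun z => score e P θ z l; P.prod (gaussianReal 0 (σ ^ 2))] =
      scoreCov e P θ σ k l := by
  obtain ⟨h1, h2, h3⟩ := integrable_score_mul_terms (σ := σ) e hP2 hP4 k l
  rw [covariance_eq_sub (memLp_score e hP2 hcov hP4 k) (memLp_score e hP2 hcov hP4 l),
    integral_score e hP2 hmean hcov hP4, zero_mul, sub_zero]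
  simp only [Pi.mul_apply, score_mul_score]
  -- The noise factors of the three terms integrate to `1`, `0` and `σ²`.
  rw [integral_add (by exact h1.add h2) h3, integral_add h1 h2,
    integral_prod_mul (fun x : Fin d → ℝ =>
      ((seen e *ᵥ x) k * ((unseen e *ᵥ θ) ⬝ᵥ residual e (covMat P) x)) *
        ((seen e *ᵥ x) l * ((unseen e *ᵥ θ) ⬝ᵥ residual e (covMat P) x))) fun _ : ℝ => (1 : ℝ),
    integral_prod_mul (fun x : Fin d → ℝ => (seen e *ᵥ x) k *
        ((seen e *ᵥ x) l * ((unseen e *ᵥ θ) ⬝ᵥ residual e (covMat P) x))) fun y : ℝ => 2 * y,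
    integral_prod_mul (fun x : Fin d → ℝ => (seen e *ᵥ x) k * (seen e *ᵥ x) l)
      fun y : ℝ => y ^ 2, integral_gaussianReal_sq, integral_const_mul, integral_id_gaussianReal]
  simp only [seen_mulVec e _ k, seen_mulVec e _ l]
  rw [integral_mul_eq_covMat hP2 hmean, scoreCov, Matrix.add_apply, Matrix.smul_apply, blockPlus_apply,
    crossMoment, of_apply]
  simp only [seen_mulVec, integral_const, probReal_univ, smul_eq_mul, mul_one, mul_zero, add_zero]
  congr 1
  · refine integral_congr_ae (ae_of_all _ fun x => ?_)
    simp only [dotProduct_comm (residual e (covMat P) x)]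
    ring
  · ring


end Population

/-! ### Measurability and continuity of the matrix inverse. -/

section Inverse

variable {n : Type*} [Fintype n] [DecidableEq n]

theorem inv_apply_eq_det_inv_mul_adjugate (A : Matrix n n ℝ) (a b : n) :
    A⁻¹ a b = A.det⁻¹ * A.adjugate a b := by
  rw [inv_def, Ring.inverse_eq_inv', Matrix.smul_apply, smul_eq_mul]

/-- Cramer's rule with `0⁻¹ = 0` stays valid at singular matrices, so the inverse is Borel
everywhere although it is shown continuous only where the determinant is nonzero. -/
theorem measurable_matrix_inv :
    Measurable fun (A : n → n → ℝ) (a b : n) => (Matrix.of A)⁻¹ a b := by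
  have h : Continuous fun A : n → n → ℝ => Matrix.of A := continuous_id
  refine measurable_pi_iff.2 fun a => measurable_pi_iff.2 fun b => ?_
  simp only [inv_apply_eq_det_inv_mul_adjugate]
  exact h.matrix_det.measurable.inv.mul (h.matrix_adjugate.matrix_elem a b).measurable

theorem tendsto_matrix_inv {α : Type*} {l : Filter α} {A : α → Matrix n n ℝ} {A₀ : Matrix n n ℝ}
    (h : Tendsto A l (𝓝 A₀)) (h₀ : A₀.det ≠ 0) : Tendsto (fun z => (A z)⁻¹) l (𝓝 A₀⁻¹) := by
  have hdet := (continuous_id.matrix_det.tendsto A₀).comp h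
  have hadj := (continuous_id.matrix_adjugate.tendsto A₀).comp h
  simp only [inv_def, Ring.inverse_eq_inv']
  exact (hdet.inv₀ h₀).smul hadj

end Inverse

/-! ### Exact error expansion of local least squares. -/

section LocalEstimate

variable {d p q : ℕ} (e : Fin p ⊕ Fin q ≃ Fin d)

/-- The matrix of empirical second moments of the seen features. -/
noncomputable def sampleCov (n : ℕ) (x : ℕ → Fin d → ℝ) : Matrix (Fin p) (Fin p) ℝ :=
  (n : ℝ)⁻¹ • ((dataMat n x * (seen e)ᵀ)ᵀ * (dataMat n x * (seen e)ᵀ))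

theorem sampleCov_apply (n : ℕ) (x : ℕ → Fin d → ℝ) (a b : Fin p) :
    sampleCov e n x a b =
      (n : ℝ)⁻¹ * ∑ j ∈ Finset.range n, x j (e (Sum.inl a)) * x j (e (Sum.inl b)) := by
  rw [sampleCov, Matrix.smul_apply, smul_eq_mul, mul_seen_transpose, Matrix.mul_apply,
    Finset.sum_range]
  rfl

/-- With `A = X Π₊ᵀ`, the labels are `A (T θ) + r`, where `r` collects prediction error and noise.
Full column rank turns `A†` into `(Aᵀ A)⁻¹ Aᵀ`, which reproduces `T θ` exactly, and `Aᵀ r` is the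
sum of the scores. -/
theorem sqrt_smul_localOLS_sub {P : Measure (Fin d → ℝ)} (hcov : (covMat P).PosDef)
    (θ : Fin d → ℝ) {n : ℕ} (hn : 0 < n) (x : ℕ → Fin d → ℝ) (ξ : ℕ → ℝ)
    (hdet : (sampleCov e n x).det ≠ 0) :
    √n • (localOLS e (dataMat n x) (labels n θ x ξ) - T e (covMat P) *ᵥ θ) =
      (sampleCov e n x)⁻¹ *ᵥ fun k =>
        (√n)⁻¹ * ∑ j ∈ Finset.range n, score e P θ (x j, ξ j) k := by
  have hn0 : (n : ℝ) ≠ 0 := by positivity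
  set A := dataMat n x * (seen e)ᵀ with hA
  have hS : Aᵀ * A = (n : ℝ) • sampleCov e n x := by
    rw [sampleCov, smul_smul, mul_inv_cancel₀ hn0, one_smul]
  have hu : IsUnit (Aᵀ * A).det := by
    rw [hS, det_smul]
    exact (mul_ne_zero (pow_ne_zero _ hn0) hdet).isUnit
  set r : Fin n → ℝ := fun j => (unseen e *ᵥ θ) ⬝ᵥ residual e (covMat P) (x j) + ξ j with hr
  have hy : labels n θ x ξ = A *ᵥ (T e (covMat P) *ᵥ θ) + r := by
    funext j
    have h1 : (dataMat n x *ᵥ θ) j = x j ⬝ᵥ θ := rfl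
    have h2 : (A *ᵥ (T e (covMat P) *ᵥ θ)) j = (seen e *ᵥ x j) ⬝ᵥ (T e (covMat P) *ᵥ θ) := by
      rw [hA, mul_seen_transpose]
      simp only [mulVec, dotProduct]
      refine Finset.sum_congr rfl fun a _ => ?_
      congr 1
      exact (seen_mulVec e (x j) a).symm
    rw [labels, h1, Pi.add_apply, h2, dotProduct_eq_seen_add_residual e (isSymm_of_posDef hcov)]
    simp only [hr]
    ring
  have hscore : Aᵀ *ᵥ r = fun k => ∑ j ∈ Finset.range n, score e P θ (x j, ξ j) k := by
    funext k
    rw [hA, mul_seen_transpose, Finset.sum_range]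
    simp only [mulVec, dotProduct, score]
    refine Finset.sum_congr rfl fun j _ => ?_
    congr 1
    exact (seen_mulVec e (x j) k).symm
  have hinv : (Aᵀ * A)⁻¹ = (n : ℝ)⁻¹ • (sampleCov e n x)⁻¹ := by
    refine inv_eq_left_inv ?_
    rw [hS, smul_mul_smul_comm, inv_mul_cancel₀ hn0, one_smul, nonsing_inv_mul _ hdet.isUnit]
  have hlin : localOLS e (dataMat n x) (labels n θ x ξ) - T e (covMat P) *ᵥ θ =
      (n : ℝ)⁻¹ • ((sampleCov e n x)⁻¹ *ᵥ (Aᵀ *ᵥ r)) := by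
    rw [localOLS, pinv_eq_of_isUnit _ hu, hy, mulVec_add, mulVec_mulVec _ (_ * Aᵀ) A,
      Matrix.mul_assoc, nonsing_inv_mul _ hu, one_mulVec,
      add_sub_cancel_left, ← mulVec_mulVec, hinv, smul_mulVec]
  have hsq : √(n : ℝ) * (n : ℝ)⁻¹ = (√n)⁻¹ := by
    rw [← Real.sqrt_div_self, div_eq_mul_inv]
  rw [hlin, smul_smul, hsq, ← mulVec_smul, hscore]
  rfl

end LocalEstimate

/-! ### Limit covariances, optimality and the two limit theorems for the samples. -/

section Asymptotics

variable {m d : ℕ} {p q : Fin m → ℕ} (e : ∀ i, Fin (p i) ⊕ Fin (q i) ≃ Fin d)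
  (P : Measure (Fin d → ℝ)) (θ : Fin d → ℝ) (σ : ℝ) (W : ∀ i, Matrix (Fin (p i)) (Fin (p i)) ℝ)

/-- The asymptotic covariance matrix of the local estimate of agent `i`. -/
noncomputable def localCov (i : Fin m) : Matrix (Fin (p i)) (Fin (p i)) ℝ :=
  (blockPlus (e i) (covMat P))⁻¹ * scoreCov (e i) P θ σ * (blockPlus (e i) (covMat P))⁻¹

/-- The asymptotic covariance matrix of the aggregated estimate. -/
noncomputable def aggCov : Matrix (Fin d) (Fin d) ℝ :=
  ∑ i, gain e (covMat P) W i * localCov e P θ σ i * (gain e (covMat P) W i)ᵀ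

/-- The matrix that maps the scores of all agents to the aggregated estimate. -/
noncomputable def scoreGain : Matrix (Fin d) (Σ i, Fin (p i)) ℝ :=
  Matrix.of fun k a => (gain e (covMat P) W a.1 * (blockPlus (e a.1) (covMat P))⁻¹) k a.2

variable {P θ σ W}

/-- The reason for the optimal weights: they are the inverse limit covariances, as in generalized
least squares. -/
theorem inv_localCov (hcov : (covMat P).PosDef) (i : Fin m) :
    (localCov e P θ σ i)⁻¹ = optWeight (e i) P θ σ := by
  have hu : IsUnit (blockPlus (e i) (covMat P)).det :=
    (Matrix.isUnit_iff_isUnit_det _).1 (blockPlus_posDef (e i) hcov).isUnit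
  rw [localCov, optWeight, Matrix.mul_inv_rev, Matrix.mul_inv_rev, nonsing_inv_nonsing_inv _ hu,
    scoreCov, Matrix.mul_assoc]

theorem localCov_posDef (hcov : (covMat P).PosDef) {i : Fin m}
    (hQ : (scoreCov (e i) P θ σ).PosDef) : (localCov e P θ σ i).PosDef := by
  have hS := (blockPlus_posDef (e i) hcov).inv
  have h := hQ.conjTranspose_mul_mul_same (B := (blockPlus (e i) (covMat P))⁻¹)
    (Matrix.mulVec_injective_iff_isUnit.2 hS.isUnit)
  rwa [hS.isHermitian.eq] at h

theorem optWeight_posDef (hcov : (covMat P).PosDef) {i : Fin m}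
    (hQ : (scoreCov (e i) P θ σ).PosDef) : (optWeight (e i) P θ σ).PosDef := by
  rw [← inv_localCov e hcov i]
  exact (localCov_posDef e hcov hQ).inv

/-- The covariance of the linear image of the stacked scores. The block diagonal form expresses
uncorrelated agents and collapses the double sum over agents to a single one. -/
theorem scoreGain_mul_blockDiagonal_mul (hcov : (covMat P).PosDef) :
    scoreGain e P W * blockDiagonal' (fun i => scoreCov (e i) P θ σ) * (scoreGain e P W)ᵀ =
      aggCov e P θ σ W := by
  have hs : ∀ i, ((blockPlus (e i) (covMat P))⁻¹)ᵀ = (blockPlus (e i) (covMat P))⁻¹ := fun i => by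
    rw [transpose_nonsing_inv, blockPlus_isSymm (e i) (isSymm_of_posDef hcov)]
  have h1 : ∀ i, gain e (covMat P) W i * localCov e P θ σ i * (gain e (covMat P) W i)ᵀ =
      (gain e (covMat P) W i * (blockPlus (e i) (covMat P))⁻¹) * scoreCov (e i) P θ σ *
        (gain e (covMat P) W i * (blockPlus (e i) (covMat P))⁻¹)ᵀ := fun i => by
    rw [transpose_mul, hs, localCov]
    simp only [Matrix.mul_assoc]
  ext k l
  simp only [aggCov, h1, Matrix.sum_apply]
  rw [Matrix.mul_apply, Fintype.sum_sigma]
  refine Finset.sum_congr rfl fun i _ => ?_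
  rw [Matrix.mul_apply]
  refine Finset.sum_congr rfl fun b _ => ?_
  congr 1
  rw [Matrix.mul_apply, Matrix.mul_apply, Fintype.sum_sigma, Finset.sum_eq_single i]
  · simp [scoreGain, blockDiagonal'_apply_eq]
  · intro j _ hj
    simp [blockDiagonal'_apply_ne _ _ _ hj]
  · simp

theorem aggCov_posSemidef (hcov : (covMat P).PosDef) (hQ : ∀ i, (scoreCov (e i) P θ σ).PosDef) :
    (aggCov e P θ σ W).PosSemidef := by
  refine posSemidef_sum _ fun i _ => ?_
  simpa [conjTranspose_eq_transpose_of_trivial] using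
    (localCov_posDef e hcov (hQ i)).posSemidef.mul_mul_conjTranspose_same
      (gain e (covMat P) W i)

/-- At the optimal weights the gain is the generalized least squares gain itself, so every square in
the Gauss–Markov identity is zero. -/
theorem aggCov_optWeight (hcover : ∀ k : Fin d, ∃ (i : Fin m) (a : Fin (p i)), e i (Sum.inl a) = k)
    (hcov : (covMat P).PosDef) (hQ : ∀ i, (scoreCov (e i) P θ σ).PosDef) :
    aggCov e P θ σ (fun i => optWeight (e i) P θ σ) =
      (infoMat e (covMat P) fun i => optWeight (e i) P θ σ)⁻¹ := by
  have hV := fun i => localCov_posDef e hcov (hQ i)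
  have hK := infoMat_posDef e hcover hcov fun i => optWeight_posDef e hcov (hQ i)
  have h := sum_mul_mul_transpose_sub_inv (A := fun i => T (e i) (covMat P)) hV
    (by simpa only [inv_localCov e hcov, infoMat] using hK) (sum_gain_mul_T e hK)
  rw [← sub_eq_zero]
  simp only [inv_localCov e hcov] at h
  refine h.trans (Finset.sum_eq_zero fun i _ => ?_)
  have : gain e (covMat P) (fun i => optWeight (e i) P θ σ) i -
      (∑ i, (T (e i) (covMat P))ᵀ * optWeight (e i) P θ σ * T (e i) (covMat P))⁻¹ *
        ((T (e i) (covMat P))ᵀ * optWeight (e i) P θ σ) = 0 := sub_self _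
  rw [this, Matrix.zero_mul, Matrix.zero_mul]

theorem aggCov_sub_aggCov_optWeight_posSemidef
    (hcover : ∀ k : Fin d, ∃ (i : Fin m) (a : Fin (p i)), e i (Sum.inl a) = k)
    (hcov : (covMat P).PosDef) (hQ : ∀ i, (scoreCov (e i) P θ σ).PosDef)
    (hW : ∀ i, (W i).PosDef) :
    (aggCov e P θ σ W - aggCov e P θ σ fun i => optWeight (e i) P θ σ).PosSemidef := by
  have hK := infoMat_posDef e hcover hcov fun i => optWeight_posDef e hcov (hQ i)
  have h := posSemidef_sum_mul_mul_transpose_sub_inv (A := fun i => T (e i) (covMat P))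
    (fun i => localCov_posDef e hcov (hQ i))
    (by simpa only [inv_localCov e hcov, infoMat] using hK)
    (sum_gain_mul_T e (infoMat_posDef e hcover hcov hW))
  rw [aggCov_optWeight e hcover hcov hQ]
  simpa only [inv_localCov e hcov, aggCov, infoMat] using h

/-- The scores of all agents at their `j`-th samples, as one vector. -/
noncomputable def scoreVec (P : Measure (Fin d → ℝ)) (θ : Fin d → ℝ)
    (z : Fin m → (Fin d → ℝ) × ℝ) : EuclideanSpace ℝ (Σ i, Fin (p i)) :=
  WithLp.toLp 2 fun a => score (e a.1) P θ (z a.1) a.2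

theorem measurable_scoreVec (hcov : (covMat P).PosDef) : Measurable (scoreVec e P θ) := by
  refine (PiLp.continuous_toLp 2 _).measurable.comp (measurable_pi_iff.2 fun a => ?_)
  exact (measurable_score (e a.1) θ hcov a.2).comp (measurable_pi_apply a.1)

variable {Ω : Type*} [MeasurableSpace Ω] {μ : Measure Ω}
  [IsProbabilityMeasure P] {σ : ℝ≥0}

/-- Asymptotic normality of the scores of all agents. -/
theorem tendstoInDistribution_scoreVec [IsProbabilityMeasure μ]
    (hP2 : ∀ k, MemLp (fun x : Fin d → ℝ => x k) 2 P) (hmean : ∀ k, ∫ x, x k ∂P = 0)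
    (hcov : (covMat P).PosDef)
    (hP4 : ∀ (i : Fin m) (k : Fin (p i)), MemLp (fun x : Fin d → ℝ =>
      (seen (e i) *ᵥ x) k * ((unseen (e i) *ᵥ θ) ⬝ᵥ residual (e i) (covMat P) x)) 2 P)
    {Z : Fin m → ℕ → Ω → (Fin d → ℝ) × ℝ}
    (hZ : ∀ i j, HasLaw (Z i j) (P.prod (gaussianReal 0 (σ ^ 2))) μ)
    (hindep : iIndepFun (fun (a : Fin m × ℕ) ω => Z a.1 a.2 ω) μ) :
    TendstoInDistribution
      (fun (n : ℕ) ω => (√n : ℝ)⁻¹ • ∑ j ∈ Finset.range n, scoreVec e P θ fun i => Z i j ω) atTop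
      (id : EuclideanSpace ℝ (Σ i, Fin (p i)) → EuclideanSpace ℝ (Σ i, Fin (p i))) (fun _ => μ)
      (multivariateGaussian 0 (blockDiagonal' fun i => scoreCov (e i) P θ σ)) := by
  -- The samples are regrouped by their number `j`, with all agents stacked, to give one sequence of
  -- i.i.d. vectors.
  have hrow : iIndepFun (fun (j : ℕ) ω (i : Fin m) => Z i j ω) μ :=
    iIndepFun_curry (X := fun j i => Z i j) (fun j i => (hZ i j).aemeasurable)
      (hindep.precomp (g := Prod.swap) Prod.swap_injective)
  have hcol : ∀ j, iIndepFun (fun i => Z i j) μ := fun j =>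
    hindep.precomp (g := fun i => (i, j)) (Prod.mk_left_injective j)
  have hid : ∀ j, IdentDistrib (fun ω (i : Fin m) => Z i j ω) (fun ω i => Z i 0 ω) μ μ := fun j =>
    identDistrib_pi (hcol j) (hcol 0) fun i =>
      ⟨(hZ i j).aemeasurable, (hZ i 0).aemeasurable, (hZ i j).map_eq.trans (hZ i 0).map_eq.symm⟩
  have hm := measurable_scoreVec e (θ := θ) hcov
  have hL2 : ∀ a : Σ i, Fin (p i),
      MemLp (fun ω => score (e a.1) P θ (Z a.1 0 ω) a.2) 2 μ := fun a => by
    have h := memLp_score (σ := σ) (e a.1) hP2 hcov (hP4 a.1) a.2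
    rw [← (hZ a.1 0).map_eq] at h
    exact h.comp_of_map (hZ a.1 0).aemeasurable
  have hmean0 : ∀ a : Σ i, Fin (p i),
      ∫ ω, score (e a.1) P θ (Z a.1 0 ω) a.2 ∂μ = 0 := fun a => by
    rw [← integral_score (σ := σ) (e a.1) hP2 hmean hcov (hP4 a.1) a.2]
    exact (hZ a.1 0).integral_comp
      (measurable_score (e a.1) θ hcov a.2).aestronglyMeasurable
  have h := tendstoInDistribution_inv_sqrt_smul_sum
    (hrow.comp (fun _ => scoreVec e P θ) fun _ => hm) (fun j => (hid j).comp hm) hL2 hmean0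
  suffices hC : (blockDiagonal' fun i => scoreCov (e i) P θ σ) =
      covOf (fun ω => scoreVec e P θ fun i => Z i 0 ω) μ by
    rw [hC]
    exact h
  ext ⟨i, a⟩ ⟨l, b⟩
  rw [covOf, of_apply]
  -- Within one agent the covariance is that of the score; between distinct agents it vanishes by
  -- independence.
  by_cases hil : i = l
  · subst hil
    rw [blockDiagonal'_apply_eq, ← covariance_score (e i) hP2 hmean hcov (hP4 i)]
    exact ((hZ i 0).covariance_fun_comp
      (measurable_score (e i) θ hcov a).aemeasurable
      (measurable_score (e i) θ hcov b).aemeasurable).symm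
  · rw [blockDiagonal'_apply_ne _ _ _ hil]
    refine (IndepFun.covariance_eq_zero ?_ (hL2 ⟨i, a⟩) (hL2 ⟨l, b⟩)).symm
    exact ((hcol 0).indepFun hil).comp (measurable_score (e i) θ hcov a)
      (measurable_score (e l) θ hcov b)

/-- Strong law of large numbers for the empirical second moments of the seen features. -/
theorem ae_tendsto_sampleCov {p q : ℕ} (e : Fin p ⊕ Fin q ≃ Fin d)
    (hP2 : ∀ k, MemLp (fun x : Fin d → ℝ => x k) 2 P) (hmean : ∀ k, ∫ x, x k ∂P = 0)
    {x : ℕ → Ω → Fin d → ℝ} (hx : ∀ j, HasLaw (x j) P μ)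
    (hindep : Pairwise fun j l => IndepFun (x j) (x l) μ) :
    ∀ᵐ ω ∂μ, Tendsto (fun n => sampleCov e n fun j => x j ω) atTop
      (𝓝 (blockPlus e (covMat P))) := by
  have hmeas : ∀ k l : Fin d, Measurable fun v : Fin d → ℝ => v k * v l := fun k l => by fun_prop
  have h : ∀ a b : Fin p, ∀ᵐ ω ∂μ, Tendsto (fun n => sampleCov e n (fun j => x j ω) a b) atTop
      (𝓝 (blockPlus e (covMat P) a b)) := fun a b => by
    have hf := hmeas (e (Sum.inl a)) (e (Sum.inl b))
    have hint : Integrable (fun ω => x 0 ω (e (Sum.inl a)) * x 0 ω (e (Sum.inl b))) μ := by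
      have h := (hP2 (e (Sum.inl a))).integrable_mul (hP2 (e (Sum.inl b)))
      rw [← (hx 0).map_eq] at h
      exact h.comp_aemeasurable (hx 0).aemeasurable
    have hE : ∫ ω, x 0 ω (e (Sum.inl a)) * x 0 ω (e (Sum.inl b)) ∂μ =
        blockPlus e (covMat P) a b := by
      rw [blockPlus_apply, ← integral_mul_eq_covMat hP2 hmean]
      exact (hx 0).integral_comp hf.aestronglyMeasurable
    have hlaw := strong_law_ae
      (fun j ω => x j ω (e (Sum.inl a)) * x j ω (e (Sum.inl b))) hint
      (fun j l hjl => (hindep hjl).comp hf hf)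
      fun j => IdentDistrib.comp (⟨(hx j).aemeasurable, (hx 0).aemeasurable,
        (hx j).map_eq.trans (hx 0).map_eq.symm⟩ : IdentDistrib (x j) (x 0) μ μ) hf
    filter_upwards [hlaw] with ω hω
    simp_rw [sampleCov_apply]
    rw [← hE]
    simpa using hω
  have h' : ∀ᵐ ω ∂μ, ∀ a b, Tendsto (fun n => sampleCov e n (fun j => x j ω) a b) atTop
      (𝓝 (blockPlus e (covMat P) a b)) := ae_all_iff.2 fun a => ae_all_iff.2 fun b => h a b
  filter_upwards [h'] with ω hω
  exact tendsto_pi_nhds.2 fun a => tendsto_pi_nhds.2 fun b => hω a b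

end Asymptotics

theorem posSemidef_blockDiagonal' {ι : Type*} [Fintype ι] [DecidableEq ι] {k : ι → Type*}
    [∀ i, Fintype (k i)] {Q : ∀ i, Matrix (k i) (k i) ℝ} (hQ : ∀ i, (Q i).PosSemidef) :
    (blockDiagonal' Q).PosSemidef := by
  refine PosSemidef.of_dotProduct_mulVec_nonneg ?_ fun v => ?_
  · rw [IsHermitian, blockDiagonal'_conjTranspose]
    congr 1
    exact funext fun i => (hQ i).isHermitian
  · have h : ∀ i a, (blockDiagonal' Q *ᵥ v) ⟨i, a⟩ = (Q i *ᵥ fun b => v ⟨i, b⟩) a := fun i a => by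
      rw [mulVec, dotProduct, Fintype.sum_sigma, Finset.sum_eq_single i]
      · simp only [blockDiagonal'_apply_eq, mulVec, dotProduct]
      · intro j _ hj
        simp [blockDiagonal'_apply_ne _ _ _ hj.symm]
      · simp
    rw [dotProduct, Fintype.sum_sigma]
    refine Finset.sum_nonneg fun i _ => ?_
    simp only [h]
    exact (hQ i).dotProduct_mulVec_nonneg fun b => v ⟨i, b⟩

/-! ### Slutsky's theorem and the limit of the aggregated estimate. -/

section Main

variable {m d : ℕ} {p q : Fin m → ℕ} (e : ∀ i, Fin (p i) ⊕ Fin (q i) ≃ Fin d)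
  {P : Measure (Fin d → ℝ)} {θ : Fin d → ℝ} {W : ∀ i, Matrix (Fin (p i)) (Fin (p i)) ℝ}

theorem aemeasurable_localEstimates {Ω : Type*} [MeasurableSpace Ω] {μ : Measure Ω}
    {x : Fin m → ℕ → Ω → Fin d → ℝ} {ξ : Fin m → ℕ → Ω → ℝ}
    (hx : ∀ i j, AEMeasurable (x i j) μ) (hξ : ∀ i j, AEMeasurable (ξ i j) μ) (n : ℕ) (i : Fin m) :
    AEMeasurable (fun ω => localEstimates e θ n (fun i j => x i j ω) (fun i j => ξ i j ω) i) μ := by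
  have hxk : ∀ j k, AEMeasurable (fun ω => x i j ω k) μ := fun j k =>
    (measurable_pi_apply k).comp_aemeasurable (hx i j)
  have hA : AEMeasurable (fun ω (j : Fin n) (a : Fin (p i)) => x i j ω (e i (Sum.inl a))) μ :=
    aemeasurable_pi_iff.2 fun j => aemeasurable_pi_iff.2 fun a => hxk j _
  have hB := measurable_pinv.comp_aemeasurable hA
  refine aemeasurable_pi_iff.2 fun a => ?_
  have heq : ∀ ω, localEstimates e θ n (fun i j => x i j ω) (fun i j => ξ i j ω) i a =
      ∑ j : Fin n, pinv (Matrix.of fun (j : Fin n) (a : Fin (p i)) =>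
        x i j ω (e i (Sum.inl a))) a j * (∑ k, x i j ω k * θ k + ξ i j ω) := fun ω => by
    rw [localEstimates, localOLS, mul_seen_transpose]
    rfl
  simp_rw [heq]
  refine Finset.aemeasurable_fun_sum _ fun j _ => AEMeasurable.mul ?_ ?_
  · exact aemeasurable_pi_iff.1 (aemeasurable_pi_iff.1 hB a) j
  · exact (Finset.aemeasurable_fun_sum _ fun k _ => (hxk j k).mul_const (θ k)).add (hξ i j)

/-- By unbiasedness, the aggregated error is exactly the gains applied to the local errors. -/
theorem sqrt_smul_aggregate_sub (hH : (infoMat e (covMat P) W).PosDef) (hW : ∀ i, (W i).PosDef)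
    (c : ℝ) (θloc : ∀ i, Fin (p i) → ℝ) :
    c • (aggregate e (covMat P) W θloc - θ) =
      ∑ i, gain e (covMat P) W i *ᵥ (c • (θloc i - T (e i) (covMat P) *ᵥ θ)) := by
  have h : ∑ i, gain e (covMat P) W i *ᵥ (T (e i) (covMat P) *ᵥ θ) = θ := by
    simp only [mulVec_mulVec]
    rw [← sum_mulVec, sum_gain_mul_T e hH, one_mulVec]
  simp only [mulVec_smul, mulVec_sub]
  rw [← Finset.smul_sum, Finset.sum_sub_distrib, h, aggregate_eq e hH hW]

/-- The aggregated estimate as a function of the scores and of the inverse empirical second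
moments. -/
noncomputable def aggMap (P : Measure (Fin d → ℝ)) (W : ∀ i, Matrix (Fin (p i)) (Fin (p i)) ℝ)
    (z : EuclideanSpace ℝ (Σ i, Fin (p i)) × (∀ i, Fin (p i) → Fin (p i) → ℝ)) :
    EuclideanSpace ℝ (Fin d) :=
  WithLp.toLp 2 (∑ i, gain e (covMat P) W i *ᵥ (Matrix.of (z.2 i) *ᵥ fun a => z.1 ⟨i, a⟩))

theorem continuous_aggMap : Continuous (aggMap e P W) := by
  refine (PiLp.continuous_toLp 2 _).comp (continuous_finsetSum _ fun i _ => ?_)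
  have h1 : Continuous fun z : EuclideanSpace ℝ (Σ i, Fin (p i)) ×
      (∀ i, Fin (p i) → Fin (p i) → ℝ) => Matrix.of (z.2 i) :=
    (continuous_apply i).comp continuous_snd
  have h2 : Continuous fun (z : EuclideanSpace ℝ (Σ i, Fin (p i)) ×
      (∀ i, Fin (p i) → Fin (p i) → ℝ)) (a : Fin (p i)) => z.1 ⟨i, a⟩ := by
    fun_prop
  exact continuous_const.matrix_mulVec (h1.matrix_mulVec h2)

/-- Freezing the second argument at its limit leaves a linear map of the scores, so a Gaussian limit
stays Gaussian. -/
theorem aggMap_inv (u : EuclideanSpace ℝ (Σ i, Fin (p i))) :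
    aggMap e P W (u, fun i a b => (blockPlus (e i) (covMat P))⁻¹ a b) =
      WithLp.toLp 2 (scoreGain e P W *ᵥ u.ofLp) := by
  have hof : ∀ i, (Matrix.of fun a b => (blockPlus (e i) (covMat P))⁻¹ a b) =
      (blockPlus (e i) (covMat P))⁻¹ := fun i => rfl
  rw [aggMap]
  congr 1
  funext k
  simp only [hof, Finset.sum_apply, mulVec_mulVec]
  rw [mulVec, dotProduct, Fintype.sum_sigma]
  rfl

theorem aemeasurable_inv_sampleCov {Ω : Type*} [MeasurableSpace Ω] {μ : Measure Ω} {p q : ℕ}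
    (e : Fin p ⊕ Fin q ≃ Fin d) {x : ℕ → Ω → Fin d → ℝ} (hx : ∀ j, AEMeasurable (x j) μ) (n : ℕ) :
    AEMeasurable (fun ω a b => (sampleCov e n fun j => x j ω)⁻¹ a b) μ := by
  have hxk : ∀ j k, AEMeasurable (fun ω => x j ω k) μ := fun j k =>
    (measurable_pi_apply k).comp_aemeasurable (hx j)
  refine measurable_matrix_inv.comp_aemeasurable
    (f := fun ω a b => sampleCov e n (fun j => x j ω) a b) ?_
  refine aemeasurable_pi_iff.2 fun a => aemeasurable_pi_iff.2 fun b => ?_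
  simp_rw [sampleCov_apply]
  exact (Finset.aemeasurable_fun_sum _ fun j _ => (hxk j _).mul (hxk j _)).const_mul _

variable {Ω : Type*} [MeasurableSpace Ω] {μ : Measure Ω} [IsProbabilityMeasure μ]
  [IsProbabilityMeasure P] {σ : ℝ≥0}

/-- Asymptotic normality of the aggregated estimate. -/
theorem tendstoInDistribution_aggregate
    (hcover : ∀ k : Fin d, ∃ (i : Fin m) (a : Fin (p i)), e i (Sum.inl a) = k)
    (hP2 : ∀ k, MemLp (fun x : Fin d → ℝ => x k) 2 P) (hmean : ∀ k, ∫ x, x k ∂P = 0)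
    (hcov : (covMat P).PosDef) (hσ : 0 < σ)
    (hP4 : ∀ (i : Fin m) (k : Fin (p i)), MemLp (fun x : Fin d → ℝ =>
      (seen (e i) *ᵥ x) k * ((unseen (e i) *ᵥ θ) ⬝ᵥ residual (e i) (covMat P) x)) 2 P)
    {x : Fin m → ℕ → Ω → Fin d → ℝ} {ξ : Fin m → ℕ → Ω → ℝ}
    (hx : ∀ i j, HasLaw (x i j) P μ)
    (hξ : ∀ i j, HasLaw (ξ i j) (gaussianReal 0 (σ ^ 2)) μ)
    (hxξ : ∀ i j, IndepFun (x i j) (ξ i j) μ)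
    (hindep : iIndepFun (fun (a : Fin m × ℕ) ω => (x a.1 a.2 ω, ξ a.1 a.2 ω)) μ)
    (hW : ∀ i, (W i).PosDef) :
    TendstoInDistribution
      (fun (n : ℕ) ω => WithLp.toLp 2 (√n • (aggregate e (covMat P) W
        (localEstimates e θ n (fun i j => x i j ω) (fun i j => ξ i j ω)) - θ)))
      atTop (id : EuclideanSpace ℝ (Fin d) → EuclideanSpace ℝ (Fin d)) (fun _ => μ)
      (multivariateGaussian 0 (aggCov e P θ σ W)) := by
  have hH := infoMat_posDef e hcover hcov hW
  have hQ : ∀ i, (scoreCov (e i) P θ σ).PosDef := fun i => scoreCov_posDef (e i) hcov (hP4 i) hσ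
  set U : ℕ → Ω → EuclideanSpace ℝ (Σ i, Fin (p i)) := fun n ω =>
    (√n : ℝ)⁻¹ • ∑ j ∈ Finset.range n, scoreVec e P θ fun i => (x i j ω, ξ i j ω) with hU
  set B : ℕ → Ω → (∀ i, Fin (p i) → Fin (p i) → ℝ) := fun n ω i a b =>
    (sampleCov (e i) n fun j => x i j ω)⁻¹ a b with hB
  set B₀ : ∀ i, Fin (p i) → Fin (p i) → ℝ := fun i a b =>
    (blockPlus (e i) (covMat P))⁻¹ a b with hB₀
  set Y : ℕ → Ω → EuclideanSpace ℝ (Fin d) := fun n ω => WithLp.toLp 2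
    (√n • (aggregate e (covMat P) W
      (localEstimates e θ n (fun i j => x i j ω) (fun i j => ξ i j ω)) - θ)) with hY
  have hUlim := tendstoInDistribution_scoreVec e hP2 hmean hcov hP4
    (Z := fun i j ω => (x i j ω, ξ i j ω)) (fun i j => (hxξ i j).hasLaw_prod (hx i j) (hξ i j))
    hindep
  have hSC : ∀ᵐ ω ∂μ, ∀ i, Tendsto (fun n => sampleCov (e i) n fun j => x i j ω) atTop
      (𝓝 (blockPlus (e i) (covMat P))) := ae_all_iff.2 fun i =>
    ae_tendsto_sampleCov (e i) hP2 hmean (hx i) fun j l hjl =>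
      (hindep.indepFun (i := (i, j)) (j := (i, l)) (by simpa using hjl)).comp
        measurable_fst measurable_fst
  have hdet₀ : ∀ i, (blockPlus (e i) (covMat P)).det ≠ 0 := fun i =>
    (blockPlus_posDef (e i) hcov).det_pos.ne'
  have hBm : ∀ n, AEMeasurable (B n) μ := fun n => aemeasurable_pi_iff.2 fun i =>
    aemeasurable_inv_sampleCov (e i) (fun j => (hx i j).aemeasurable) n
  have hBlim : TendstoInMeasure μ B atTop fun _ => B₀ := by
    refine tendstoInMeasure_of_tendsto_ae (fun n => (hBm n).aestronglyMeasurable) ?_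
    filter_upwards [hSC] with ω hω
    refine tendsto_pi_nhds.2 fun i => tendsto_pi_nhds.2 fun a => tendsto_pi_nhds.2 fun b => ?_
    exact ((continuous_id.matrix_elem a b).tendsto _).comp (tendsto_matrix_inv (hω i) (hdet₀ i))
  have hYm : ∀ n, AEMeasurable (Y n) μ := fun n => by
    have hf : Continuous fun t : ∀ i, Fin (p i) → ℝ =>
        WithLp.toLp 2 (√n • ((∑ i, gain e (covMat P) W i *ᵥ t i) - θ)) := by
      refine (PiLp.continuous_toLp 2 _).comp (Continuous.fun_const_smul ?_ (√n : ℝ))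
      exact (continuous_finsetSum _ fun i _ =>
        continuous_const.matrix_mulVec (continuous_apply i)).sub continuous_const
    have h := hf.measurable.comp_aemeasurable (aemeasurable_pi_iff.2 fun i =>
      aemeasurable_localEstimates e (θ := θ) (fun i j => (hx i j).aemeasurable)
        (fun i j => (hξ i j).aemeasurable) n i)
    simp only [hY, aggregate_eq e hH hW]
    exact h
  -- Slutsky: the scores converge in distribution, the inverse sample moments in measure to a
  -- constant, and `aggMap` is continuous.
  have hG := hUlim.continuous_comp_prodMk_of_tendstoInMeasure_const
    (continuous_aggMap e (P := P) (W := W)) hBlim hBm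
  -- Almost surely the sample moment matrices are eventually invertible. From then on the expansion
  -- is exact and the difference is identically zero, so the value of `A†` on rank-deficient data
  -- does not affect the limit.
  have hdiff : TendstoInMeasure μ (Y - fun n ω => aggMap e P W (U n ω, B n ω)) atTop 0 := by
    refine tendstoInMeasure_of_tendsto_ae
      (fun n => ((hYm n).sub (hG.forall_aemeasurable n)).aestronglyMeasurable) ?_
    filter_upwards [hSC] with ω hω
    have hne : ∀ᶠ n in atTop, ∀ i, (sampleCov (e i) n fun j => x i j ω).det ≠ 0 :=
      eventually_all.2 fun i => (((continuous_id.matrix_det.tendsto _).comp (hω i)).eventually_ne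
        (hdet₀ i))
    refine tendsto_const_nhds.congr' ?_
    filter_upwards [hne, eventually_gt_atTop 0] with n hn hpos
    rw [eq_comm, Pi.sub_apply, Pi.sub_apply, Pi.zero_apply, sub_eq_zero]
    simp only [hY, aggMap, sqrt_smul_aggregate_sub e hH hW]
    congr 1
    refine Finset.sum_congr rfl fun i _ => ?_
    congr 1
    refine (sqrt_smul_localOLS_sub (e i) hcov θ hpos _ _ (hn i)).trans ?_
    congr 1
    funext k
    simp [hU, scoreVec]
  have hfin := tendstoInDistribution_of_tendstoInMeasure_sub Y _ hG hdiff hYm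
  refine ⟨hfin.forall_aemeasurable, aemeasurable_id, ?_⟩
  have hmap : (multivariateGaussian 0 (blockDiagonal' fun i => scoreCov (e i) P θ σ)).map
      (fun u => aggMap e P W (id u, B₀)) = (multivariateGaussian 0 (aggCov e P θ σ W)).map id := by
    have hps : (blockDiagonal' fun i => scoreCov (e i) P θ σ).PosSemidef :=
      posSemidef_blockDiagonal' fun i => (hQ i).posSemidef
    simp only [hB₀, id_eq, aggMap_inv, Measure.map_id]
    rw [multivariateGaussian_map_mulVec hps, scoreGain_mul_blockDiagonal_mul e hcov]
  convert hfin.tendsto using 2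
  exact congrArg 𝓝 (Subtype.ext hmap.symm)

end Main

end Collab

theorem mainTheorem3 {m d : ℕ} {p q : Fin m → ℕ}
    -- the views of the agents; every feature is seen by at least one agent
    (e : ∀ i, Fin (p i) ⊕ Fin (q i) ≃ Fin d)
    (hcover : ∀ k : Fin d, ∃ (i : Fin m) (a : Fin (p i)), e i (Sum.inl a) = k)
    -- the feature distribution, the parameter and the noise level
    (P : Measure (Fin d → ℝ)) [IsProbabilityMeasure P]
    (hP2 : ∀ k, MemLp (fun x : Fin d → ℝ => x k) 2 P)
    (hmean : ∀ k, ∫ x, x k ∂P = 0)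
    (hcov : (Collab.covMat P).PosDef)
    (θ : Fin d → ℝ) (σ : ℝ≥0) (hσ : 0 < σ)
    (hP4 : ∀ (i : Fin m) (k : Fin (p i)), MemLp (fun x : Fin d → ℝ =>
      (Collab.seen (e i) *ᵥ x) k *
        ((Collab.unseen (e i) *ᵥ θ) ⬝ᵥ Collab.residual (e i) (Collab.covMat P) x)) 2 P)
    -- the samples: `x i j` and `ξ i j` are the `j`-th feature vector and noise of agent `i`
    {Ω : Type*} [MeasurableSpace Ω] (μ : Measure Ω) [IsProbabilityMeasure μ]
    (x : Fin m → ℕ → Ω → Fin d → ℝ) (ξ : Fin m → ℕ → Ω → ℝ)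
    (hx : ∀ i j, HasLaw (x i j) P μ)
    (hξ : ∀ i j, HasLaw (ξ i j) (gaussianReal 0 (σ ^ 2)) μ)
    (hxξ : ∀ i j, IndepFun (x i j) (ξ i j) μ)
    (hindep : iIndepFun (fun (a : Fin m × ℕ) ω => (x a.1 a.2 ω, ξ a.1 a.2 ω)) μ) :
    ∃ C : (∀ i, Matrix (Fin (p i)) (Fin (p i)) ℝ) → Matrix (Fin d) (Fin d) ℝ,
      (∀ W : ∀ i, Matrix (Fin (p i)) (Fin (p i)) ℝ, (∀ i, (W i).PosDef) →
        -- the aggregated estimator is the unique minimizer of the weighted objective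
        (∀ n ω t, IsMinOn (Collab.aggObjective e (Collab.covMat P) W
            (Collab.localEstimates e θ n (fun i j => x i j ω) (fun i j => ξ i j ω))) Set.univ t ↔
          t = Collab.aggregate e (Collab.covMat P) W
            (Collab.localEstimates e θ n (fun i j => x i j ω) (fun i j => ξ i j ω))) ∧
        (C W).PosSemidef ∧
        TendstoInDistribution
          (fun (n : ℕ) ω => WithLp.toLp 2 (Real.sqrt n •
            (Collab.aggregate e (Collab.covMat P) W
              (Collab.localEstimates e θ n (fun i j => x i j ω) (fun i j => ξ i j ω)) - θ)))
          atTop (id : EuclideanSpace ℝ (Fin d) → EuclideanSpace ℝ (Fin d)) (fun _ => μ)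
          (multivariateGaussian 0 (C W))) ∧
      (∀ i, (Collab.optWeight (e i) P θ σ).PosDef) ∧
      C (fun i => Collab.optWeight (e i) P θ σ) =
        (∑ i, (Collab.T (e i) (Collab.covMat P))ᵀ * Collab.optWeight (e i) P θ σ *
          Collab.T (e i) (Collab.covMat P))⁻¹ ∧
      ∀ W : ∀ i, Matrix (Fin (p i)) (Fin (p i)) ℝ, (∀ i, (W i).PosDef) →
        (C W - C (fun i => Collab.optWeight (e i) P θ σ)).PosSemidef := by
  have hQ : ∀ i, (Collab.scoreCov (e i) P θ σ).PosDef := fun i =>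
    Collab.scoreCov_posDef (e i) hcov (hP4 i) hσ
  refine ⟨Collab.aggCov e P θ σ, fun W hW => ⟨fun n ω t => ?_, ?_, ?_⟩, fun i => ?_, ?_,
    fun W hW => ?_⟩
  · have hH := Collab.infoMat_posDef e hcover hcov hW
    rw [Collab.isMinOn_aggObjective_iff e hH hW, Collab.aggregate_eq e hH hW]
  · exact Collab.aggCov_posSemidef e hcov hQ
  · exact Collab.tendstoInDistribution_aggregate e hcover hP2 hmean hcov hσ hP4 hx hξ hxξ hindep hW
  · exact Collab.optWeight_posDef e hcov (hQ i)
  · exact Collab.aggCov_optWeight e hcover hcov hQ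
  · exact Collab.aggCov_sub_aggCov_optWeight_posSemidef e hcover hcov hQ hW
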